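/- Consider walks in $\mathbb{Z}^2$ with diagonal steps $(1,1),(1,-1),(-1,1),(-1,-1)$, and let $\mathcal H=\{(k,0): k\in\mathbb{Z},\ k\le 0\}$. For $(i,j)\in\mathbb{Z}^2$ and $n\ge 0$, let $a_{i,j}(n)$ be the number of such walks $w_0,\dots,w_n$ with $w_0=(0,0)$, $w_n=(i,j)$ and $w_1,\dots,w_n\notin\mathcal H$, and let $S_{i,j}(t)=\sum_{n\ge0}a_{i,j}(n)t^n\in\mathbb{Q}[[t]]$. Let $C_n=\frac1{n+1}\binom{2n}{n}$ be the Catalan numbers, $C(t)=\sum_{n\ge0}C_nt^n$, and $$u=\frac{\sqrt{1+4t}-1}{\sqrt{1-4t}+1},$$ where $\sqrt{1\pm4t}$ denotes the power series with constant term $1$; all fields below are taken inside the field $\mathbb{Q}((t))$ of Laurent series. **Theorem (diagonal square lattice: prescribed endpoint).** For all $i,j\in\mathbb{Z}$, the series $S_{i,j}(t)$ belongs to $\mathbb{Q}(u)=\mathbb{Q}(t,\sqrt{1-4t},\sqrt{1+4t})$, and it can be computed explicitly: there is an algorithm that, given $(i,j)$, returns two polynomials $P,Q$ with integer coefficients such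 that $Q(u)\ne0$ and $S_{i,j}=P(u)/Q(u)$. If $i+j$ is even and $(i,j)\notin\mathcal H$, then $S_{i,j}$ has degree $2$ or $4$ over $\mathbb{Q}(t)$. (For every other $(i,j)$, no such walk of positive length ends at $(i,j)$.) In particular, $$S_{1,1}(t)=\frac{u(1+u^2)}{1-u^2}=\frac{2-\sqrt{1-4t}-\sqrt{1+4t}}{4t}=\sum_{n\ge0}C_{2n+1}t^{2n+1},$$ $$S_{-1,1}(t)=u=\frac{\sqrt{1+4t}-1}{\sqrt{1-4t}+1}=\sum_{n\ge0}\left(2\cdot4^nC_n-C_{2n+1}\right)t^{2n+1},$$ $$S_{0,2}(t)=\frac{2u^2}{1-u^2}=\frac{\sqrt{1+4t}-\sqrt{1-4t}-4t}{4t}=\sum_{n\ge1}C_{2n}t^{2n},$$ and for every integer $i\ge1$, $$S_{2i,0}(t)=\binom{2i}{i}t^{2i}C(4t^2)^{2i}=\sum_{n\ge i}\frac in\binom{2i}{i}\binom{2n}{n-i}4^{n-i}t^{2n}.$$ -/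

import Mathlib

open scoped PowerSeries LaurentSeries

noncomputable section

namespace SlitPlane

/-- The forbidden horizontal half-axis `{(k, 0) : k ≤ 0}`. -/
def halfLine : Set (ℤ × ℤ) := {p | p.1 ≤ 0 ∧ p.2 = 0}

/-- The four diagonal steps. -/
def diagonalSteps : Finset (ℤ × ℤ) := {(1, 1), (1, -1), (-1, 1), (-1, -1)}

/-- The walks `w₀, …, wₙ` of length `n` with steps in `A` that start from the origin, end at `p`,
and none of whose vertices `w₁, …, wₙ` lies on the half-line: walks on the slit plane. -/
def walks (A : Finset (ℤ × ℤ)) (p : ℤ × ℤ) (n : ℕ) : Set (Fin (n + 1) → ℤ × ℤ) :=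
  {w | w 0 = (0, 0) ∧ w (Fin.last n) = p ∧
    ∀ k : Fin n, w k.succ - w k.castSucc ∈ A ∧ w k.succ ∉ halfLine}

/-- There are finitely many walks of given length and endpoint. -/
theorem walks_finite (A : Finset (ℤ × ℤ)) (p : ℤ × ℤ) (n : ℕ) : (walks A p n).Finite := by
  refine Set.Finite.of_injOn (t := Set.pi Set.univ fun _ : Fin n => (A : Set (ℤ × ℤ)))
    (f := fun w k => w k.succ - w k.castSucc) ?_ ?_ ?_
  · intro w hw k _
    exact (hw.2.2 k).1
  · intro w hw v hv h
    funext k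
    induction k using Fin.induction with
    | zero => rw [hw.1, hv.1]
    | succ k ih =>
      have h1 := congrFun h k
      simp only at h1
      rw [ih] at h1
      exact sub_left_injective h1
  · exact Set.Finite.pi fun _ => A.finite_toSet

/-- The number `a_{i,j}(n)` of diagonal walks of length `n` on the slit plane ending at `(i, j)`. -/
def a (i j : ℤ) (n : ℕ) : ℕ := (walks diagonalSteps (i, j) n).ncard

/-- The generating function `S_{i,j}(t) = ∑ a_{i,j}(n) tⁿ`. -/
def S (i j : ℤ) : ℚ⟦X⟧ := PowerSeries.mk fun n => (a i j n : ℚ)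

/-- The variable `t`, in the field of Laurent series. -/
def t : ℚ⸨X⸩ := ((PowerSeries.X : ℚ⟦X⟧) : ℚ⸨X⸩)

/-- The power series `√(1 + c t) = ∑ binom(1/2, n) cⁿ tⁿ`. -/
def sqrtSeries (c : ℚ) : ℚ⟦X⟧ :=
  PowerSeries.rescale c (PowerSeries.binomialSeries ℚ (1 / 2 : ℚ))

theorem sqrtSeries_sq (c : ℚ) : sqrtSeries c ^ 2 = 1 + PowerSeries.C c * PowerSeries.X := by
  have h : PowerSeries.binomialSeries ℚ (1 / 2 : ℚ) ^ 2 = 1 + PowerSeries.X := by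
    have h1 := PowerSeries.binomialSeries_nat (R := ℚ) (A := ℚ) 1
    rw [sq, ← PowerSeries.binomialSeries_add]
    norm_num at h1 ⊢
    exact h1
  rw [sqrtSeries, ← map_pow, h, map_add, map_one, PowerSeries.rescale_X]

theorem constantCoeff_sqrtSeries (c : ℚ) : PowerSeries.constantCoeff (sqrtSeries c) = 1 := by
  simp [sqrtSeries, ← PowerSeries.coeff_zero_eq_constantCoeff_apply, PowerSeries.coeff_rescale,
    PowerSeries.binomialSeries_coeff]

/-- `√(1 + 4t)` in the field of Laurent series. -/
def rPlus : ℚ⸨X⸩ := (sqrtSeries 4 : ℚ⸨X⸩)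

/-- `√(1 - 4t)` in the field of Laurent series. -/
def rMinus : ℚ⸨X⸩ := (sqrtSeries (-4) : ℚ⸨X⸩)

/-- The series `u = (√(1 + 4t) - 1) / (√(1 - 4t) + 1)`. -/
def u : ℚ⸨X⸩ := (rPlus - 1) / (rMinus + 1)

/-- The series `∑ c(n) t^(2n+1)`, over `n ≥ 0`. -/
def oddSeries (c : ℕ → ℚ) : ℚ⟦X⟧ := PowerSeries.mk fun m => if Odd m then c (m / 2) else 0

/-- The series `∑ c(n) t^(2n)`, over `n ≥ 0`. -/
def evenSeries (c : ℕ → ℚ) : ℚ⟦X⟧ := PowerSeries.mk fun m => if Even m then c (m / 2) else 0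

/-- The series `C(4t²) = ∑ Cₙ (4t²)ⁿ`, where `Cₙ` is the `n`th Catalan number. -/
def catalanAtFourTSq : ℚ⸨X⸩ := (evenSeries fun n => (catalan n : ℚ) * 4 ^ n : ℚ⸨X⸩)

/-- The value at `x` of the integer polynomial whose list of coefficients, from the constant
coefficient upwards, is `l`. -/
def polyEval (l : List ℤ) (x : ℚ⸨X⸩) : ℚ⸨X⸩ := l.foldr (fun c r => (c : ℚ⸨X⸩) + x * r) 0

end SlitPlane

end

open scoped PowerSeries LaurentSeries

noncomputable section

namespace SlitPlane

/-! Put c = 2tC(4t²), so that c = 2t(1 + c²), write e = x + 1/x, and let Y be the power series root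
of Y = te(1 + Y²). The claim behind everything is that Yʲ/√(1 - c²x²) is the generating function, in
t and the abscissa x, of the walks ending at height j ≥ 0. It is verified rather than derived
(`coeff_xCoeff_row`). Off the axis the recurrence is the kernel equation. On the axis it rests on
the Wiener–Hopf factorization (1 + c²)√(1 - 4t²e²) = √(1 - c²x²) √(1 - c²/x²) (`root_mul_root`),
where √(1 - 4t²e²) = 1 - 2teY.

Height 0 is then a binomial series in c². At height 1, the nonpositive powers of x give sums of
neighbours S_{i-1,1} + S_{i+1,1}; their alternating sum telescopes to c S_{-1,1} = √(1 + c²) - 1,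
whence S_{-1,1} = u. Greater heights follow from a relation expressing S_{i,j+2} through finitely
many series of heights j and j + 1 (`S_add_two_relation`), obtained by applying x d/dx to a row and
eliminating. Since t, c and 1/c are rational in u, so is every S_{i,j}, with denominator (u - u⁵)ᴺ
and with explicit bounds on N and on the degree of the numerator (`S_mem_uFilt`).

With these bounds the algorithm needs no algebra on the recurrences: the inverse of u is t = z(1 -
z²)/(1 + z²)², so the numerator is the polynomial (z - z⁵)ᴺ S_{i,j}(t(z)), whose coefficients are
finite integer combinations of walk counts (`polyEval_numerator`).

For the degree, S_{i,j} lies in a tower of two extensions of ℚ(t) of degree at most 2, so its degree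
divides 4. It is not 1: at t = 1/4 the series converges while ∑ n a(n) tⁿ diverges, which a rational
series with nonnegative coefficients cannot do (`summable_mul_of_rational`). This is read off the
Catalan numbers for S_{1,1} and transferred to the other endpoints by joining them to (1,1) by paths
off the half-line. -/

/-! ### Recurrence, symmetry and support of the walk counts -/

/-- Removing the last vertex is a bijection once the last step s is fixed; different s give
different penultimate vertices, so the union is disjoint. -/
theorem ncard_walks_succ (A : Finset (ℤ × ℤ)) (p : ℤ × ℤ) (n : ℕ) (hp : p ∉ halfLine) :
    (walks A p (n + 1)).ncard = ∑ s ∈ A, (walks A (p - s) n).ncard := by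
  classical
  have key : (walks_finite A p (n + 1)).toFinset =
      A.biUnion fun s => (walks_finite A (p - s) n).toFinset.image
        fun w => (Fin.snoc w p : Fin (n + 2) → ℤ × ℤ) := by
    ext w
    simp only [Set.Finite.mem_toFinset, Finset.mem_biUnion, Finset.mem_image]
    constructor
    · rintro ⟨h0, hl, hs⟩
      refine ⟨p - w (Fin.last n).castSucc, ?_, Fin.init w, ⟨?_, ?_, ?_⟩, ?_⟩
      · have := (hs (Fin.last n)).1
        rwa [Fin.succ_last, hl] at this
      · exact h0
      · simp [Fin.init]
      · intro k
        have := hs k.castSucc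
        exact this
      · rw [← hl]
        exact Fin.snoc_init_self w
    · rintro ⟨s, hs, v, ⟨h0, hl, hv⟩, rfl⟩
      refine ⟨?_, by simp, ?_⟩
      · have : (0 : Fin (n + 2)) = Fin.castSucc 0 := rfl
        rw [this, Fin.snoc_castSucc, h0]
      · intro k
        induction k using Fin.lastCases with
        | last =>
          rw [Fin.succ_last, Fin.snoc_last, Fin.snoc_castSucc, hl]
          simpa using ⟨hs, hp⟩
        | cast k =>
          rw [← Fin.castSucc_succ, Fin.snoc_castSucc, Fin.snoc_castSucc]
          exact hv k
  rw [Set.ncard_eq_toFinset_card _ (walks_finite A p (n + 1)), key, Finset.card_biUnion]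
  · refine Finset.sum_congr rfl fun s _ => ?_
    rw [Finset.card_image_of_injective, Set.ncard_eq_toFinset_card _ (walks_finite A (p - s) n)]
    intro w v h
    have := congrArg Fin.init h
    simpa using this
  · intro s _ r _ hsr
    rw [Function.onFun, Finset.disjoint_left]
    intro w h1 h2
    simp only [Set.Finite.mem_toFinset, Finset.mem_image] at h1 h2
    obtain ⟨v, hv, rfl⟩ := h1
    obtain ⟨v', hv', h⟩ := h2
    have h3 : v' = v := by simpa using congrArg Fin.init h
    rw [h3] at hv'
    exact hsr (sub_right_injective (hv.2.1.symm.trans hv'.2.1))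

theorem a_zero (i j : ℤ) : a i j 0 = if i = 0 ∧ j = 0 then 1 else 0 := by
  rw [a]
  split_ifs with h
  · rw [h.1, h.2, Set.ncard_eq_one]
    refine ⟨fun _ => (0, 0), ?_⟩
    ext w
    simp only [walks, Set.mem_ofPred_eq, Set.mem_singleton_iff]
    constructor
    · rintro ⟨h0, -⟩
      funext k
      rw [Subsingleton.elim (α := Fin 1) k 0, h0]
    · rintro rfl
      exact ⟨rfl, rfl, fun k => k.elim0⟩
  · rw [Set.ncard_eq_zero (walks_finite _ _ _)]
    ext w
    simp only [walks, Set.mem_ofPred_eq, Set.mem_empty_iff_false, iff_false]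
    rintro ⟨h0, h1, -⟩
    have : (Fin.last 0) = 0 := rfl
    rw [this, h0, Prod.mk.injEq] at h1
    exact h ⟨h1.1.symm, h1.2.symm⟩

theorem a_succ_of_mem (i j : ℤ) (n : ℕ) (h : i ≤ 0 ∧ j = 0) : a i j (n + 1) = 0 := by
  rw [a, Set.ncard_eq_zero (walks_finite _ _ _)]
  ext w
  simp only [walks, Set.mem_ofPred_eq, Set.mem_empty_iff_false, iff_false]
  rintro ⟨-, h1, h2⟩
  apply (h2 (Fin.last n)).2
  rw [Fin.succ_last, h1]
  exact h

theorem a_succ (i j : ℤ) (n : ℕ) (h : ¬(i ≤ 0 ∧ j = 0)) :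
    a i j (n + 1) = a (i - 1) (j - 1) n + a (i - 1) (j + 1) n + a (i + 1) (j - 1) n
      + a (i + 1) (j + 1) n := by
  rw [a, ncard_walks_succ _ _ _ (by simpa [halfLine] using h)]
  simp [diagonalSteps, a, add_assoc]

theorem a_neg (i j : ℤ) (n : ℕ) : a i (-j) n = a i j n := by
  induction n generalizing i j with
  | zero => simp [a_zero]
  | succ n ih =>
    by_cases h : i ≤ 0 ∧ j = 0
    · rw [a_succ_of_mem i j n h, a_succ_of_mem i (-j) n (by simpa using h)]
    · rw [a_succ i j n h, a_succ i (-j) n (by simpa using h)]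
      rw [show -j - 1 = -(j + 1) by ring, show -j + 1 = -(j - 1) by ring]
      simp only [ih]
      ring

theorem a_eq_zero_of_odd (i j : ℤ) (n : ℕ) (h : Odd (i + j)) : a i j n = 0 := by
  induction n generalizing i j with
  | zero =>
    rw [a_zero, if_neg]
    rintro ⟨rfl, rfl⟩
    simp at h
  | succ n ih =>
    by_cases hm : i ≤ 0 ∧ j = 0
    · rw [a_succ_of_mem i j n hm]
    · rw [a_succ i j n hm]
      obtain ⟨m, hm⟩ := h
      rw [ih _ _ ⟨m - 1, by linarith⟩, ih _ _ ⟨m, by linarith⟩, ih _ _ ⟨m, by linarith⟩,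
        ih _ _ ⟨m + 1, by linarith⟩]

theorem a_eq_zero_of_lt (i j : ℤ) (n : ℕ) (h : (n : ℤ) < |i|) : a i j n = 0 := by
  induction n generalizing i j with
  | zero =>
    rw [a_zero, if_neg]
    rintro ⟨rfl, rfl⟩
    simp at h
  | succ n ih =>
    by_cases hm : i ≤ 0 ∧ j = 0
    · rw [a_succ_of_mem i j n hm]
    · rw [a_succ i j n hm]
      push_cast at h
      have h1 : (n : ℤ) < |i - 1| := by
        have := abs_sub_abs_le_abs_sub i 1
        simp at this; linarith
      have h2 : (n : ℤ) < |i + 1| := by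
        have := abs_sub_abs_le_abs_sub i (-1)
        simp at this; linarith
      rw [ih _ _ h1, ih _ _ h1, ih _ _ h2, ih _ _ h2]

/-! ### Comparison of the counts at different endpoints -/

/-- `p` and `r` dominate each other: up to a shift of the length, the number of walks ending at
either point is at most the number of walks ending at the other. -/
def Comparable (p r : ℤ × ℤ) : Prop :=
  (∃ m, ∀ n, a p.1 p.2 n ≤ a r.1 r.2 (n + m)) ∧ ∃ m, ∀ n, a r.1 r.2 n ≤ a p.1 p.2 (n + m)

theorem Comparable.symm {p r : ℤ × ℤ} (h : Comparable p r) : Comparable r p := ⟨h.2, h.1⟩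

theorem Comparable.trans {p r s : ℤ × ℤ} (h : Comparable p r) (h' : Comparable r s) :
    Comparable p s := by
  obtain ⟨⟨m₁, h₁⟩, m₂, h₂⟩ := h
  obtain ⟨⟨m₃, h₃⟩, m₄, h₄⟩ := h'
  refine ⟨⟨m₁ + m₃, fun n => ?_⟩, m₄ + m₂, fun n => ?_⟩
  · rw [← add_assoc]
    exact (h₁ n).trans (h₃ _)
  · rw [← add_assoc]
    exact (h₄ n).trans (h₂ _)

/-- A walk to (i, j) can be extended by one diagonal step to (k, l), which is allowed because (k, l)
is off the half-line. -/
theorem a_le_of_adjacent (i j k l : ℤ) (h : ¬(k ≤ 0 ∧ l = 0)) (hi : |i - k| = 1)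
    (hj : |j - l| = 1) (n : ℕ) : a i j n ≤ a k l (n + 1) := by
  rw [a_succ k l n h]
  have h1 : i = k - 1 ∨ i = k + 1 := by
    rcases (abs_eq (by norm_num)).1 hi with h | h
    · right; linarith
    · left; linarith
  have h2 : j = l - 1 ∨ j = l + 1 := by
    rcases (abs_eq (by norm_num)).1 hj with h | h
    · right; linarith
    · left; linarith
  rcases h1 with rfl | rfl <;> rcases h2 with rfl | rfl <;> omega

theorem comparable_of_adjacent (i j k l : ℤ) (h : ¬(i ≤ 0 ∧ j = 0)) (h' : ¬(k ≤ 0 ∧ l = 0))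
    (hi : |i - k| = 1) (hj : |j - l| = 1) : Comparable (i, j) (k, l) :=
  ⟨⟨1, a_le_of_adjacent i j k l h' hi hj⟩,
    ⟨1, a_le_of_adjacent k l i j h (by rwa [abs_sub_comm]) (by rwa [abs_sub_comm])⟩⟩

theorem comparable_refl (p : ℤ × ℤ) : Comparable p p := ⟨⟨0, fun _ => le_rfl⟩, ⟨0, fun _ => le_rfl⟩⟩

theorem comparable_row_one (k : ℤ) : Comparable (2 * k + 1, 1) (1, 1) := by
  have step (k : ℤ) : Comparable (2 * k + 1, 1) (2 * (k + 1) + 1, 1) :=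
    -- The detour through height 2 stays off the axis.
    (comparable_of_adjacent _ _ (2 * k + 2) 2 (by omega) (by omega)
      (by rw [show 2 * k + 1 - (2 * k + 2) = -1 by ring]; rfl) (by rfl)).trans
    (comparable_of_adjacent _ _ _ _ (by omega) (by omega)
      (by rw [show 2 * k + 2 - (2 * (k + 1) + 1) = -1 by ring]; rfl) (by rfl))
  induction k using Int.induction_on with
  | zero => exact comparable_refl _
  | succ i ih => exact (step i).symm.trans ih
  | pred i ih =>
    refine Comparable.trans ?_ ih
    have := step (-i - 1)
    rwa [sub_add_cancel] at this

theorem comparable_upper (j : ℕ) (i : ℤ) (h : Even (i + (j + 1 : ℕ))) :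
    Comparable (i, (j + 1 : ℕ)) (1, 1) := by
  induction j generalizing i with
  | zero =>
    obtain ⟨m, hm⟩ := h
    have hi : i = 2 * (m - 1) + 1 := by push_cast at hm; linarith
    rw [hi]
    exact comparable_row_one _
  | succ j ih =>
    refine Comparable.trans ?_ (ih (i - 1) ?_)
    · exact comparable_of_adjacent _ _ _ _ (by omega) (by omega) (by simp) (by push_cast; simp)
    · obtain ⟨m, hm⟩ := h
      exact ⟨m - 1, by push_cast at hm ⊢; linarith⟩

/-- Any such endpoint is joined to (1, 1) by a diagonal path off the half-line: descend to height 1,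
then move along it. Negative heights are reflected, and a point of the positive axis first moves up
by one step. -/
theorem comparable_one_one (i j : ℤ) (h : Even (i + j)) (hm : (i, j) ∉ halfLine) :
    Comparable (i, j) (1, 1) := by
  have hm' : ¬(i ≤ 0 ∧ j = 0) := by simpa [halfLine] using hm
  rcases lt_trichotomy j 0 with hj | rfl | hj
  · obtain ⟨l, hl⟩ := Int.eq_ofNat_of_zero_le (a := -j - 1) (by omega)
    have hj' : -j = (l + 1 : ℕ) := by push_cast; linarith
    have := comparable_upper l i (by
      rw [← hj']
      obtain ⟨m, hm⟩ := h
      exact ⟨m - j, by linarith⟩)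
    rw [← hj'] at this
    simpa only [Comparable, a_neg] using this
  · refine (comparable_of_adjacent _ _ (i - 1) 1 hm' (by omega) (by simp) (by simp)).trans ?_
    obtain ⟨m, hm⟩ := h
    have : i - 1 = 2 * (m - 1) + 1 := by linarith
    rw [this]
    exact comparable_row_one _
  · obtain ⟨l, hl⟩ := Int.eq_ofNat_of_zero_le (a := j - 1) (by omega)
    have hj' : j = (l + 1 : ℕ) := by push_cast; linarith
    rw [hj'] at h ⊢
    exact comparable_upper l i h

/-! ### Catalan series and the rational parametrization by `u` -/

open PowerSeries in
theorem eq_of_sq_eq_sq_of_constantCoeff {R : Type*} [CommRing R] [IsDomain R] [CharZero R]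
    {f g : R⟦X⟧} (h : f ^ 2 = g ^ 2) (hf : constantCoeff f = 1) (hg : constantCoeff g = 1) :
    f = g := by
  rcases sq_eq_sq_iff_eq_or_eq_neg.1 h with h | h
  · exact h
  · rw [h, map_neg, hg] at hf
    exfalso
    have : (2 : R) = 0 := by linear_combination -hf
    exact two_ne_zero this

open PowerSeries in
theorem ne_zero_of_constantCoeff_eq_one {R : Type*} [CommRing R] [Nontrivial R]
    {f : R⟦X⟧} (h : constantCoeff f = 1) : f ≠ 0 := by
  rintro rfl
  simp at h

/-- The generating function of the Catalan numbers. -/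
def catalanGF : ℚ⟦X⟧ := PowerSeries.catalanSeries.map (Nat.castRingHom ℚ)

theorem coeff_catalanGF (n : ℕ) : PowerSeries.coeff n catalanGF = catalan n := by
  simp [catalanGF]

theorem catalanGF_eq : catalanGF = 1 + PowerSeries.X * catalanGF ^ 2 := by
  have h := congrArg (PowerSeries.map (Nat.castRingHom ℚ))
    PowerSeries.catalanSeries_sq_mul_X_add_one
  simp only [map_add, map_mul, map_pow, PowerSeries.map_X, map_one] at h
  rw [catalanGF]
  linear_combination -h

theorem sqrtSeries_neg_four : sqrtSeries (-4) = 1 - 2 * PowerSeries.X * catalanGF := by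
  refine eq_of_sq_eq_sq_of_constantCoeff ?_ (constantCoeff_sqrtSeries _) (by simp)
  rw [sqrtSeries_sq, map_neg, show (PowerSeries.C (4 : ℚ) : ℚ⟦X⟧) = 4 from map_ofNat _ 4]
  linear_combination 4 * PowerSeries.X * catalanGF_eq

theorem sqrtSeries_four :
    sqrtSeries 4 = 1 + 2 * PowerSeries.X * PowerSeries.rescale (-1) catalanGF := by
  refine eq_of_sq_eq_sq_of_constantCoeff ?_ (constantCoeff_sqrtSeries _) (by simp)
  have h := congrArg (PowerSeries.rescale (-1 : ℚ)) catalanGF_eq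
  simp only [map_add, map_mul, map_pow, PowerSeries.rescale_X, map_one, map_neg] at h
  rw [sqrtSeries_sq, show (PowerSeries.C (4 : ℚ) : ℚ⟦X⟧) = 4 from map_ofNat _ 4]
  linear_combination -4 * PowerSeries.X * h

/-- The series `C(t²)`. -/
def catalanSqGF : ℚ⟦X⟧ := PowerSeries.expand 2 two_ne_zero catalanGF

theorem catalanSqGF_eq : catalanSqGF = 1 + PowerSeries.X ^ 2 * catalanSqGF ^ 2 := by
  have h := congrArg (PowerSeries.expand 2 two_ne_zero) catalanGF_eq
  simp only [map_add, map_mul, map_pow, PowerSeries.expand_X, map_one] at h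
  exact h

theorem evenSeries_catalan_four :
    (evenSeries fun n => (catalan n : ℚ) * 4 ^ n) = PowerSeries.rescale 2 catalanSqGF := by
  ext m
  rw [evenSeries, PowerSeries.coeff_mk, PowerSeries.coeff_rescale, catalanSqGF,
    PowerSeries.coeff_expand]
  simp only [even_iff_two_dvd]
  split_ifs with h
  · obtain ⟨k, rfl⟩ := h
    rw [coeff_catalanGF, Nat.mul_div_cancel_left k two_pos, pow_mul]
    norm_num [mul_comm]
  · simp

/-- The series `2tC(4t²)`. -/
def cSeries : ℚ⟦X⟧ := 2 * PowerSeries.X * PowerSeries.rescale 2 catalanSqGF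

theorem cSeries_eq : cSeries = 2 * PowerSeries.X * (1 + cSeries ^ 2) := by
  have h := congrArg (PowerSeries.rescale (2 : ℚ)) catalanSqGF_eq
  simp only [map_add, map_mul, map_pow, PowerSeries.rescale_X, map_one] at h
  rw [show (PowerSeries.C (2 : ℚ) : ℚ⟦X⟧) = 2 from map_ofNat _ 2] at h
  rw [cSeries]
  linear_combination 2 * PowerSeries.X * h

theorem constantCoeff_cSeries : PowerSeries.constantCoeff cSeries = 0 := by
  simp [cSeries]

/-- The series `u`, as a power series. -/
def uSeries : ℚ⟦X⟧ := (sqrtSeries 4 - 1) * (sqrtSeries (-4) + 1)⁻¹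

theorem uSeries_mul : uSeries * (sqrtSeries (-4) + 1) = sqrtSeries 4 - 1 := by
  rw [uSeries, mul_assoc, PowerSeries.inv_mul_cancel, mul_one]
  rw [map_add, constantCoeff_sqrtSeries]
  norm_num

theorem uSeries_mul' : uSeries * (sqrtSeries 4 + 1) = 1 - sqrtSeries (-4) := by
  have h1 := sqrtSeries_sq 4
  have h2 := sqrtSeries_sq (-4)
  rw [map_neg] at h2
  have h0 : sqrtSeries (-4) + 1 ≠ 0 := fun h => by
    have := congrArg PowerSeries.constantCoeff h
    rw [map_add, constantCoeff_sqrtSeries] at this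
    norm_num at this
  apply mul_right_cancel₀ h0
  linear_combination (sqrtSeries 4 + 1) * uSeries_mul + h1 + h2

theorem constantCoeff_uSeries : PowerSeries.constantCoeff uSeries = 0 := by
  simp [uSeries, constantCoeff_sqrtSeries]

theorem sqrtSeries_neg_four_mul :
    sqrtSeries (-4) * (1 + uSeries ^ 2) = 1 - 2 * uSeries - uSeries ^ 2 := by
  linear_combination uSeries * uSeries_mul + uSeries_mul'

theorem sqrtSeries_four_mul :
    sqrtSeries 4 * (1 + uSeries ^ 2) = 1 + 2 * uSeries - uSeries ^ 2 := by
  linear_combination -uSeries_mul + uSeries * uSeries_mul'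

/-- With u = tan θ this says 4t = sin 4θ; the two preceding formulas say √(1 ± 4t) = cos 2θ ± sin
2θ, and `cSeries_mul` says c = tan 2θ. -/
theorem X_mul_uSeries :
    PowerSeries.X * (1 + uSeries ^ 2) ^ 2 = uSeries * (1 - uSeries ^ 2) := by
  have h1 := sqrtSeries_sq 4
  rw [show (PowerSeries.C (4 : ℚ) : ℚ⟦X⟧) = 4 from map_ofNat _ 4] at h1
  have h4 : (4 : ℚ⟦X⟧) ≠ 0 := fun h => by
    have := congrArg PowerSeries.constantCoeff h
    rw [map_ofNat, map_zero] at this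
    norm_num at this
  apply mul_left_cancel₀ h4
  linear_combination (sqrtSeries 4 * (1 + uSeries ^ 2) + (1 + 2 * uSeries - uSeries ^ 2)) *
    sqrtSeries_four_mul - (1 + uSeries ^ 2) ^ 2 * h1

/-- After substituting t in terms of u, the quadratic equation of c has the roots 2u/(1 - u²) and (1
- u²)/(2u). The constant terms exclude the second. -/
theorem cSeries_mul : cSeries * (1 - uSeries ^ 2) = 2 * uSeries := by
  have h : (cSeries * (1 - uSeries ^ 2) - 2 * uSeries) *
      (1 - uSeries ^ 2 - 2 * uSeries * cSeries) = 0 := by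
    linear_combination (1 + uSeries ^ 2) ^ 2 * cSeries_eq +
      2 * (1 + cSeries ^ 2) * X_mul_uSeries
  rcases mul_eq_zero.1 h with h | h
  · exact sub_eq_zero.1 h
  · exact absurd h (ne_zero_of_constantCoeff_eq_one (by simp [constantCoeff_uSeries]))

theorem one_add_cSeries_sq_mul :
    (1 + cSeries ^ 2) * (1 - uSeries ^ 2) ^ 2 = (1 + uSeries ^ 2) ^ 2 := by
  linear_combination (cSeries * (1 - uSeries ^ 2) + 2 * uSeries) * cSeries_mul

theorem one_sub_uSeries_sq_ne_zero : 1 - uSeries ^ 2 ≠ 0 :=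
  ne_zero_of_constantCoeff_eq_one (by simp [constantCoeff_uSeries])

theorem one_add_uSeries_sq_ne_zero : 1 + uSeries ^ 2 ≠ 0 :=
  ne_zero_of_constantCoeff_eq_one (by simp [constantCoeff_uSeries])

theorem uSeries_ne_zero : uSeries ≠ 0 := by
  intro h
  have := X_mul_uSeries
  rw [h] at this
  simp [PowerSeries.X_ne_zero] at this

/-! ### Series in `t` over the Laurent polynomials in `x` -/

/-- Power series in `t` whose coefficients are Laurent polynomials in `x`. -/
abbrev BiSeries : Type := PowerSeries (LaurentPolynomial ℚ)

instance : IsDomain (LaurentPolynomial ℚ) where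

instance : CharZero (LaurentPolynomial ℚ) := algebraRat.charZero _

/-- The monomial `x ^ s`. -/
def xPow (s : ℤ) : BiSeries := PowerSeries.C (LaurentPolynomial.T s)

theorem xPow_zero : xPow 0 = 1 := by simp [xPow]

theorem xPow_add (s r : ℤ) : xPow (s + r) = xPow s * xPow r := by
  rw [xPow, LaurentPolynomial.T_add, map_mul]; rfl

theorem xPow_mul_neg (s : ℤ) : xPow s * xPow (-s) = 1 := by
  rw [← xPow_add, add_neg_cancel, xPow_zero]

/-- Series in `t` as series with coefficients in `ℚ[x, 1/x]`. -/
def scalar : ℚ⟦X⟧ →+* BiSeries := PowerSeries.map LaurentPolynomial.C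

theorem constantCoeff_scalar (c : ℚ⟦X⟧) : PowerSeries.constantCoeff (scalar c) =
    LaurentPolynomial.C (PowerSeries.constantCoeff c) := by
  rw [← PowerSeries.coeff_zero_eq_constantCoeff_apply, scalar, PowerSeries.coeff_map,
    PowerSeries.coeff_zero_eq_constantCoeff_apply]

theorem scalar_X : scalar PowerSeries.X = PowerSeries.X := by simp [scalar]

/-- The coefficient of `x ^ i`, a series in `t`. -/
def xCoeff (i : ℤ) : BiSeries →+ ℚ⟦X⟧ where
  toFun f := PowerSeries.mk fun n => (PowerSeries.coeff n f).coeff i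
  map_zero' := by ext; simp
  map_add' f g := by ext; simp

theorem coeff_xCoeff (i : ℤ) (f : BiSeries) (n : ℕ) :
    PowerSeries.coeff n (xCoeff i f) = (PowerSeries.coeff n f).coeff i := by
  simp [xCoeff]

theorem laurent_coeff_C_mul (r : ℚ) (f : LaurentPolynomial ℚ) (i : ℤ) :
    (LaurentPolynomial.C r * f).coeff i = r * f.coeff i := by
  rw [← LaurentPolynomial.smul_eq_C_mul]; simp

theorem laurent_coeff_T_mul (s : ℤ) (f : LaurentPolynomial ℚ) (i : ℤ) :
    (LaurentPolynomial.T s * f).coeff i = f.coeff (i - s) := by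
  induction f using LaurentPolynomial.induction_on' with
  | add p q hp hq =>
    simp only [mul_add, AddMonoidAlgebra.coeff_add, Finsupp.add_apply, hp, hq]
  | C_mul_T n r =>
    rw [mul_left_comm, ← LaurentPolynomial.T_add, laurent_coeff_C_mul, laurent_coeff_C_mul,
      LaurentPolynomial.T_apply, LaurentPolynomial.T_apply]
    congr 1
    simp only [eq_sub_iff_add_eq, add_comm]

theorem xCoeff_scalar_mul (i : ℤ) (c : ℚ⟦X⟧) (f : BiSeries) :
    xCoeff i (scalar c * f) = c * xCoeff i f := by
  ext n
  rw [coeff_xCoeff, PowerSeries.coeff_mul, PowerSeries.coeff_mul]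
  have : (fun f : LaurentPolynomial ℚ => f.coeff i) =
    (⟨⟨fun f => f.coeff i, rfl⟩, fun _ _ => rfl⟩ : LaurentPolynomial ℚ →+ ℚ) := rfl
  change (fun f : LaurentPolynomial ℚ => f.coeff i) _ = _
  rw [this, map_sum]
  refine Finset.sum_congr rfl fun p _ => ?_
  rw [← this]
  simp only [scalar, PowerSeries.coeff_map]
  rw [laurent_coeff_C_mul, coeff_xCoeff]

theorem xCoeff_xPow_mul (i s : ℤ) (f : BiSeries) :
    xCoeff i (xPow s * f) = xCoeff (i - s) f := by
  ext n
  rw [coeff_xCoeff, xPow, PowerSeries.coeff_C_mul, laurent_coeff_T_mul, coeff_xCoeff]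

theorem hasSubst_xPow_mul (s : ℤ) {g : ℚ⟦X⟧} (hg : PowerSeries.constantCoeff g = 0) :
    PowerSeries.HasSubst (xPow s * scalar g) := by
  apply PowerSeries.HasSubst.of_constantCoeff_zero'
  rw [map_mul, constantCoeff_scalar, hg, map_zero, mul_zero]

/-- In f(xˢ g(t)) the power x^(sd) occurs only through the term f_d gᵈ; for s ≠ 0 each coefficient
of x is therefore a single monomial in g, as the next two lemmas record. -/
theorem xCoeff_subst (s : ℤ) {g : ℚ⟦X⟧} (hg : PowerSeries.constantCoeff g = 0) (f : ℚ⟦X⟧)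
    (i : ℤ) (n : ℕ) :
    PowerSeries.coeff n (xCoeff i (f.subst (xPow s * scalar g))) =
      finsum fun d : ℕ => if i = s * d then PowerSeries.coeff d f * PowerSeries.coeff n (g ^ d)
        else 0 := by
  have hS := hasSubst_xPow_mul s hg
  rw [coeff_xCoeff, PowerSeries.coeff_subst' hS]
  have : (fun f : LaurentPolynomial ℚ => f.coeff i) =
    (⟨⟨fun f => f.coeff i, rfl⟩, fun _ _ => rfl⟩ : LaurentPolynomial ℚ →+ ℚ) := rfl
  change (fun f : LaurentPolynomial ℚ => f.coeff i) _ = _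
  rw [this, AddMonoidHom.map_finsum _ (PowerSeries.coeff_subst_finite' hS f n)]
  refine finsum_congr fun d => ?_
  rw [← this]
  have hx : xPow s ^ d = PowerSeries.C (LaurentPolynomial.T (s * d)) := by
    rw [xPow, ← map_pow, LaurentPolynomial.T_pow, mul_comm]
  have h1 : PowerSeries.coeff n ((xPow s * scalar g) ^ d) =
      LaurentPolynomial.T (s * d) * LaurentPolynomial.C (PowerSeries.coeff n (g ^ d)) := by
    rw [mul_pow, hx, PowerSeries.coeff_C_mul, ← map_pow, scalar, PowerSeries.coeff_map]
  simp only [h1]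
  rw [LaurentPolynomial.smul_eq_C_mul, laurent_coeff_C_mul, laurent_coeff_T_mul,
    LaurentPolynomial.C_apply]
  simp only [sub_eq_zero, mul_ite, mul_zero]

theorem xCoeff_subst_mul (s : ℤ) (hs : s ≠ 0) {g : ℚ⟦X⟧} (hg : PowerSeries.constantCoeff g = 0)
    (f : ℚ⟦X⟧) (k : ℕ) :
    xCoeff (s * k) (f.subst (xPow s * scalar g)) =
      PowerSeries.C (PowerSeries.coeff k f) * g ^ k := by
  ext n
  rw [xCoeff_subst s hg, finsum_eq_single _ k, if_pos rfl, PowerSeries.coeff_C_mul]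
  intro d hd
  rw [if_neg]
  intro h
  have := mul_left_cancel₀ hs h
  exact hd (by exact_mod_cast this.symm)

theorem xCoeff_subst_of_ne (s : ℤ) {g : ℚ⟦X⟧} (hg : PowerSeries.constantCoeff g = 0)
    (f : ℚ⟦X⟧) (i : ℤ) (h : ∀ k : ℕ, i ≠ s * k) :
    xCoeff i (f.subst (xPow s * scalar g)) = 0 := by
  ext n
  rw [xCoeff_subst s hg, finsum_eq_zero_of_forall_eq_zero]
  · simp
  · intro d
    rw [if_neg (h d)]

/-! ### Kernel root, Wiener–Hopf factorization and generating functions of rows -/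

/-- The series `√(1 + X)` -/
def sqrtOneAdd : ℚ⟦X⟧ := PowerSeries.binomialSeries ℚ (1 / 2 : ℚ)

theorem sqrtOneAdd_sq : sqrtOneAdd ^ 2 = 1 + PowerSeries.X := by
  have h1 := PowerSeries.binomialSeries_nat (R := ℚ) (A := ℚ) 1
  rw [sqrtOneAdd, sq, ← PowerSeries.binomialSeries_add]
  norm_num at h1 ⊢
  exact h1

/-- The series `1 / √(1 + X)` -/
def invSqrtOneAdd : ℚ⟦X⟧ := PowerSeries.binomialSeries ℚ (-(1 / 2) : ℚ)

theorem sqrtOneAdd_mul : sqrtOneAdd * invSqrtOneAdd = 1 := by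
  rw [sqrtOneAdd, invSqrtOneAdd, ← PowerSeries.binomialSeries_add, add_neg_cancel,
    PowerSeries.binomialSeries_zero]

theorem constantCoeff_neg_cSeries_sq : PowerSeries.constantCoeff (-cSeries ^ 2) = 0 := by
  simp [constantCoeff_cSeries]

/-- The series `√(1 - c² x ^ s)`. -/
def root (s : ℤ) : BiSeries := sqrtOneAdd.subst (xPow s * scalar (-cSeries ^ 2))

/-- The series `1 / √(1 - c² x ^ s)`. -/
def invRoot (s : ℤ) : BiSeries := invSqrtOneAdd.subst (xPow s * scalar (-cSeries ^ 2))

theorem root_sq (s : ℤ) : root s ^ 2 = 1 - xPow s * scalar cSeries ^ 2 := by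
  have hS := hasSubst_xPow_mul s constantCoeff_neg_cSeries_sq
  rw [root, ← PowerSeries.coe_substAlgHom hS, ← map_pow, sqrtOneAdd_sq, map_add, map_one,
    PowerSeries.coe_substAlgHom, PowerSeries.subst_X hS, map_neg, map_pow]
  ring

theorem root_mul_invRoot (s : ℤ) : root s * invRoot s = 1 := by
  have hS := hasSubst_xPow_mul s constantCoeff_neg_cSeries_sq
  rw [root, invRoot, ← PowerSeries.coe_substAlgHom hS, ← map_mul, sqrtOneAdd_mul, map_one]

theorem constantCoeff_root (s : ℤ) : PowerSeries.constantCoeff (root s) = 1 := by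
  have hS := hasSubst_xPow_mul s constantCoeff_neg_cSeries_sq
  have : sqrtOneAdd = 1 + (sqrtOneAdd - 1) := by ring
  rw [root, this, ← PowerSeries.coe_substAlgHom hS, map_add, map_one, map_add, map_one,
    PowerSeries.coe_substAlgHom hS, add_eq_left]
  apply PowerSeries.constantCoeff_subst_eq_zero
  · rw [← PowerSeries.constantCoeff, map_mul, constantCoeff_scalar,
      constantCoeff_neg_cSeries_sq, map_zero, mul_zero]
  · simp [sqrtOneAdd]

/-- The Laurent polynomial `x + 1/x`. -/
def eSum : BiSeries := xPow 1 + xPow (-1)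

/-- The small root `Y` of the kernel `Y = t (x + 1/x) (1 + Y²)`. -/
def kernelRoot : BiSeries :=
  PowerSeries.rescale (LaurentPolynomial.T 1 + LaurentPolynomial.T (-1))
    (scalar (PowerSeries.X * catalanSqGF))

theorem kernelRoot_eq : kernelRoot = PowerSeries.X * eSum * (1 + kernelRoot ^ 2) := by
  have h := congrArg (fun f => PowerSeries.rescale (LaurentPolynomial.T 1 + LaurentPolynomial.T (-1))
    (scalar (PowerSeries.X * f))) catalanSqGF_eq
  simp only [map_add, map_mul, map_pow, scalar_X, PowerSeries.rescale_X, map_one] at h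
  rw [kernelRoot, map_mul, scalar_X, map_mul, PowerSeries.rescale_X, eSum]
  simp only [map_add, xPow]
  linear_combination h

theorem constantCoeff_kernelRoot : PowerSeries.constantCoeff kernelRoot = 0 := by
  rw [kernelRoot_eq]; simp

/-- By the kernel equation (1 - 2teY)² = 1 - 4t²e². Multiplying by (1 + c²)² and using 2t(1 + c²) =
c gives (1 + c²)² - c²(x + 1/x)² = (1 - c²x²)(1 - c²/x²). Both sides have constant term 1, which
fixes the sign of the square root. -/
theorem root_mul_root :
    (1 + scalar cSeries ^ 2) * (1 - 2 * PowerSeries.X * eSum * kernelRoot) =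
      root 2 * root (-2) := by
  apply eq_of_sq_eq_sq_of_constantCoeff
  · have h1 := root_sq 2
    have h2 := root_sq (-2)
    have h3 := kernelRoot_eq
    have h4 := congrArg scalar cSeries_eq
    simp only [map_add, map_mul, map_pow, scalar_X, map_one, map_ofNat] at h4
    have hx : xPow 2 = xPow 1 ^ 2 := by rw [sq, ← xPow_add]; rfl
    have hy : xPow (-2) = xPow (-1) ^ 2 := by rw [sq, ← xPow_add]; rfl
    have hxy := xPow_mul_neg 1
    rw [hx] at h1
    rw [hy] at h2
    rw [mul_pow (root 2), h1, h2]
    have h5 : (1 - 2 * PowerSeries.X * eSum * kernelRoot) ^ 2 =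
        1 - 4 * PowerSeries.X ^ 2 * eSum ^ 2 := by
      linear_combination -4 * PowerSeries.X * eSum * h3
    rw [mul_pow, h5, eSum]
    linear_combination (scalar cSeries + 2 * PowerSeries.X * (1 + scalar cSeries ^ 2)) *
      (xPow 1 + xPow (-1)) ^ 2 * h4 - scalar cSeries ^ 4 * (xPow 1 * xPow (-1) + 1) * hxy
      - 2 * scalar cSeries ^ 2 * hxy
  · rw [map_mul, map_add, map_one, map_pow, constantCoeff_scalar,
      constantCoeff_cSeries, map_sub, map_mul _ _ kernelRoot, constantCoeff_kernelRoot]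
    simp
  · rw [map_mul, constantCoeff_root, constantCoeff_root, one_mul]

/-- The generating function of the walks ending at height `j`. -/
def row (j : ℕ) : BiSeries := kernelRoot ^ j * invRoot 2

theorem xCoeff_X_mul (i : ℤ) (f : BiSeries) :
    xCoeff i (PowerSeries.X * f) = PowerSeries.X * xCoeff i f := by
  rw [← scalar_X, xCoeff_scalar_mul]

theorem xCoeff_eSum_mul (i : ℤ) (f : BiSeries) :
    xCoeff i (eSum * f) = xCoeff (i - 1) f + xCoeff (i + 1) f := by
  rw [eSum, add_mul, map_add, xCoeff_xPow_mul, xCoeff_xPow_mul, sub_neg_eq_add]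

theorem row_succ (j : ℕ) :
    row (j + 1) = PowerSeries.X * (eSum * (row j + row (j + 2))) := by
  simp only [row]
  linear_combination kernelRoot ^ j * invRoot 2 * kernelRoot_eq

/-- The factor √(1 - c²x²) cancels, so the defect of the unrestricted recurrence on the axis has no
positive powers of x: the recurrence holds at every allowed axis point. The factor 2 accounts for
arrivals from heights 1 and -1. -/
theorem row_zero : (1 + scalar cSeries ^ 2) * (row 0 - 2 * PowerSeries.X * eSum * row 1) =
    root (-2) := by
  simp only [row]
  linear_combination invRoot 2 * root_mul_root + root (-2) * root_mul_invRoot 2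

theorem xCoeff_root_of_pos (i : ℤ) (h : 0 < i) : xCoeff i (root (-2)) = 0 :=
  xCoeff_subst_of_ne _ constantCoeff_neg_cSeries_sq _ _ fun k => by omega

theorem xCoeff_root (k : ℕ) : xCoeff (-2 * k) (root (-2)) =
    PowerSeries.C (Ring.choose (1 / 2 : ℚ) k) * (-cSeries ^ 2) ^ k := by
  rw [root, xCoeff_subst_mul _ (by norm_num) constantCoeff_neg_cSeries_sq, sqrtOneAdd,
    PowerSeries.binomialSeries_coeff, smul_eq_mul, mul_one]

theorem xCoeff_row_zero_of_neg (i : ℤ) (h : i < 0) : xCoeff i (row 0) = 0 := by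
  rw [row, pow_zero, one_mul]
  exact xCoeff_subst_of_ne _ constantCoeff_neg_cSeries_sq _ _ fun k => by omega

theorem xCoeff_row_zero (k : ℕ) : xCoeff (2 * k) (row 0) =
    PowerSeries.C (Ring.choose (-(1 / 2) : ℚ) k) * (-cSeries ^ 2) ^ k := by
  rw [row, pow_zero, one_mul, invRoot,
    xCoeff_subst_mul _ (by norm_num) constantCoeff_neg_cSeries_sq, invSqrtOneAdd,
    PowerSeries.binomialSeries_coeff, smul_eq_mul, mul_one]

theorem one_add_cSeries_sq_ne_zero : 1 + cSeries ^ 2 ≠ 0 :=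
  ne_zero_of_constantCoeff_eq_one (by simp [constantCoeff_cSeries])

theorem xCoeff_row_one_add (i : ℤ) :
    2 * PowerSeries.X * (1 + cSeries ^ 2) * (xCoeff (i - 1) (row 1) + xCoeff (i + 1) (row 1)) =
      (1 + cSeries ^ 2) * xCoeff i (row 0) - xCoeff i (root (-2)) := by
  have h : scalar (1 + cSeries ^ 2) * (row 0 - scalar (2 * PowerSeries.X) * (eSum * row 1)) =
      root (-2) := by
    simp only [map_add, map_mul, map_pow, scalar_X, map_one, map_ofNat]
    rw [← row_zero]; ring
  rw [← h, xCoeff_scalar_mul, map_sub, xCoeff_scalar_mul, xCoeff_eSum_mul]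
  ring

theorem xCoeff_row_zero_of_pos (i : ℤ) (h : 0 < i) : xCoeff i (row 0) =
    2 * PowerSeries.X * (xCoeff (i - 1) (row 1) + xCoeff (i + 1) (row 1)) := by
  have := xCoeff_row_one_add i
  rw [xCoeff_root_of_pos i h, sub_zero] at this
  apply mul_left_cancel₀ one_add_cSeries_sq_ne_zero
  rw [← this]; ring

/-- The rows satisfy the recurrence and boundary values that determine the counts: `row_succ` above
the axis, `row_zero` on its positive half, and, for i ≤ 0, a height-0 row reduced to the constant 1,
the empty walk. Induction on the length concludes. -/
theorem coeff_xCoeff_row (n : ℕ) (i : ℤ) (j : ℕ) :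
    PowerSeries.coeff n (xCoeff i (row j)) = a i j n := by
  have zero (i : ℤ) (hi : i ≤ 0) : xCoeff i (row 0) = if i = 0 then 1 else 0 := by
    split_ifs with h
    · have := xCoeff_row_zero 0
      simpa [h] using this
    · exact xCoeff_row_zero_of_neg i (by omega)
  induction n generalizing i j with
  | zero =>
    rw [a_zero]
    cases j with
    | zero =>
      rcases le_or_gt i 0 with hi | hi
      · rw [zero i hi]
        by_cases h : i = 0 <;> simp [h]
      · rw [xCoeff_row_zero_of_pos i hi, mul_assoc, mul_left_comm, PowerSeries.coeff_zero_X_mul,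
          if_neg (by omega), Nat.cast_zero]
    | succ j =>
      rw [row_succ, xCoeff_X_mul, PowerSeries.coeff_zero_X_mul, if_neg (by omega), Nat.cast_zero]
  | succ n ih =>
    cases j with
    | zero =>
      rcases le_or_gt i 0 with hi | hi
      · rw [zero i hi, Nat.cast_zero, a_succ_of_mem i _ n ⟨hi, rfl⟩]
        split_ifs <;> simp [PowerSeries.coeff_one]
      · rw [xCoeff_row_zero_of_pos i hi, mul_assoc, mul_left_comm, PowerSeries.coeff_succ_X_mul,
          a_succ i _ n (by omega), two_mul, map_add, map_add, ih, ih]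
        have h1 (i : ℤ) : a i ((0 : ℕ) - 1) n = a i (1 : ℕ) n := by
          rw [← a_neg]; rfl
        have h2 (i : ℤ) : a i ((0 : ℕ) + 1) n = a i (1 : ℕ) n := rfl
        rw [h1, h1, h2, h2]
        push_cast
        ring
    | succ j =>
      rw [row_succ, xCoeff_X_mul, PowerSeries.coeff_succ_X_mul, xCoeff_eSum_mul, map_add, map_add,
        map_add, map_add, map_add, ih, ih, ih, ih, a_succ i _ n (by omega)]
      push_cast
      rw [show (j : ℤ) + 1 - 1 = j by ring, show (j : ℤ) + 1 + 1 = j + 2 by ring]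
      ring

/-! ### First consequences for `S`, and the derivation `x d/dx` -/

theorem S_neg (i j : ℤ) : S i (-j) = S i j := by
  ext n
  simp only [S, a_neg]

theorem xCoeff_row (i : ℤ) (j : ℕ) : xCoeff i (row j) = S i j := by
  ext n
  rw [coeff_xCoeff_row, S, PowerSeries.coeff_mk]

theorem S_eq_zero_of_odd (i j : ℤ) (h : Odd (i + j)) : S i j = 0 := by
  ext n
  simp [S, a_eq_zero_of_odd i j n h]

theorem S_two_mul_zero (k : ℕ) : S (2 * k) 0 =
    PowerSeries.C (Ring.choose (-(1 / 2) : ℚ) k) * (-cSeries ^ 2) ^ k := by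
  rw [← xCoeff_row_zero, xCoeff_row]; rfl

/-- The operator `x d/dx` on Laurent polynomials. -/
def laurentEuler (f : LaurentPolynomial ℚ) : LaurentPolynomial ℚ :=
  .ofCoeff (Finsupp.onFinset f.coeff.support (fun i => (i : ℚ) * f.coeff i) fun i h => by
    simpa using right_ne_zero_of_mul h)

theorem coeff_laurentEuler (f : LaurentPolynomial ℚ) (i : ℤ) :
    (laurentEuler f).coeff i = i * f.coeff i := rfl

theorem laurentEuler_add (f g : LaurentPolynomial ℚ) :
    laurentEuler (f + g) = laurentEuler f + laurentEuler g := by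
  ext i
  simp only [coeff_laurentEuler, AddMonoidAlgebra.coeff_add, Finsupp.add_apply]
  ring

theorem laurentEuler_mul (f g : LaurentPolynomial ℚ) :
    laurentEuler (f * g) = f * laurentEuler g + g * laurentEuler f := by
  induction f using LaurentPolynomial.induction_on' with
  | add p q hp hq => rw [add_mul, laurentEuler_add, hp, hq, laurentEuler_add]; ring
  | C_mul_T n r =>
    have h : laurentEuler (LaurentPolynomial.C r * LaurentPolynomial.T n) =
        LaurentPolynomial.C (n * r) * LaurentPolynomial.T n := by
      ext i
      rw [coeff_laurentEuler, laurent_coeff_C_mul, laurent_coeff_C_mul, LaurentPolynomial.T_apply]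
      split_ifs with h
      · rw [h]; ring
      · ring
    rw [h]
    ext i
    rw [mul_comm g]
    simp only [coeff_laurentEuler, AddMonoidAlgebra.coeff_add, Finsupp.add_apply, mul_assoc,
      laurent_coeff_C_mul, laurent_coeff_T_mul]
    push_cast
    ring

/-- The derivation `x d/dx`. -/
def euler : Derivation ℚ BiSeries BiSeries :=
  Derivation.mk'
    { toFun := fun f => PowerSeries.mk fun n => laurentEuler (PowerSeries.coeff n f)
      map_add' := fun f g => by
        ext n : 1
        simp only [PowerSeries.coeff_mk, map_add, laurentEuler_add]
      map_smul' := fun r f => by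
        ext n i
        simp [coeff_laurentEuler]
        ring }
    fun f g => by
      ext n : 1
      simp only [LinearMap.coe_mk, AddHom.coe_mk, PowerSeries.coeff_mk, map_add, smul_eq_mul,
        PowerSeries.coeff_mul]
      have h := map_sum (⟨⟨laurentEuler, by ext; simp [coeff_laurentEuler]⟩, laurentEuler_add⟩ :
        LaurentPolynomial ℚ →+ LaurentPolynomial ℚ)
        (fun p : ℕ × ℕ => PowerSeries.coeff p.1 f * PowerSeries.coeff p.2 g)
        (Finset.HasAntidiagonal.antidiagonal n)
      refine h.trans ?_
      rw [← Finset.Nat.sum_antidiagonal_swap (f := fun p : ℕ × ℕ => PowerSeries.coeff p.1 g *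
        laurentEuler (PowerSeries.coeff p.2 f)), ← Finset.sum_add_distrib]
      exact Finset.sum_congr rfl fun p _ => laurentEuler_mul _ _

theorem coeff_euler (f : BiSeries) (n : ℕ) :
    PowerSeries.coeff n (euler f) = laurentEuler (PowerSeries.coeff n f) :=
  PowerSeries.coeff_mk n fun n => laurentEuler (PowerSeries.coeff n f)

theorem xCoeff_euler (i : ℤ) (f : BiSeries) : xCoeff i (euler f) = (i : ℚ⟦X⟧) * xCoeff i f := by
  ext n
  rw [coeff_xCoeff, coeff_euler, coeff_laurentEuler,
    show (i : ℚ⟦X⟧) = PowerSeries.C (i : ℚ) from (map_intCast _ i).symm, PowerSeries.coeff_C_mul,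
    coeff_xCoeff]

theorem euler_scalar (c : ℚ⟦X⟧) : euler (scalar c) = 0 := by
  ext n i
  rw [coeff_euler, coeff_laurentEuler, scalar, PowerSeries.coeff_map, LaurentPolynomial.C_apply]
  split_ifs with h <;> simp [h]

theorem euler_X : euler PowerSeries.X = 0 := by rw [← scalar_X, euler_scalar]

theorem euler_xPow (s : ℤ) : euler (xPow s) = (s : BiSeries) * xPow s := by
  ext n i
  rw [coeff_euler, coeff_laurentEuler, xPow,
    show (s : BiSeries) = PowerSeries.C (LaurentPolynomial.C (s : ℚ)) by simp,
    PowerSeries.coeff_C_mul, laurent_coeff_C_mul, PowerSeries.coeff_C]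
  split_ifs with h
  · rw [LaurentPolynomial.T_apply]
    split_ifs with h
    · rw [h]
    · simp
  · simp

/-- The Laurent polynomial `x - 1/x`. -/
def eDiff : BiSeries := xPow 1 - xPow (-1)

theorem euler_eSum : euler eSum = eDiff := by
  rw [eSum, map_add, euler_xPow, euler_xPow, eDiff]
  push_cast
  ring

theorem euler_kernelRoot : (1 - 2 * PowerSeries.X * eSum * kernelRoot) * euler kernelRoot =
    PowerSeries.X * eDiff * (1 + kernelRoot ^ 2) := by
  have h := congrArg euler kernelRoot_eq
  simp only [Derivation.leibniz, Derivation.leibniz_pow, map_add, euler_eSum, euler_X,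
    Derivation.map_one_eq_zero, smul_eq_mul, nsmul_eq_mul] at h
  linear_combination h

theorem euler_root : 2 * root 2 * euler (root 2) = -2 * xPow 2 * scalar cSeries ^ 2 := by
  have h := congrArg euler (root_sq 2)
  simp only [Derivation.leibniz, Derivation.leibniz_pow, map_sub, euler_xPow, euler_scalar,
    Derivation.map_one_eq_zero, smul_eq_mul, nsmul_eq_mul] at h
  linear_combination h

theorem euler_invRoot :
    (1 - xPow 2 * scalar cSeries ^ 2) * euler (invRoot 2) =
      xPow 2 * scalar cSeries ^ 2 * invRoot 2 := by
  have h := congrArg euler (root_mul_invRoot 2)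
  simp only [Derivation.leibniz, Derivation.map_one_eq_zero, smul_eq_mul] at h
  have h2 : (2 : BiSeries) * ((1 - xPow 2 * scalar cSeries ^ 2) * euler (invRoot 2)) =
      2 * (xPow 2 * scalar cSeries ^ 2 * invRoot 2) := by
    rw [← root_sq]
    linear_combination 2 * root 2 * h - invRoot 2 * euler_root
  have h3 : (2 : BiSeries) ≠ 0 := fun h => by
    have := congrArg PowerSeries.constantCoeff h
    rw [map_ofNat, map_zero] at this
    norm_num at this
  exact mul_left_cancel₀ h3 h2

/-- The derivatives of Y and of 1/√(1 - c²x²) have denominators 1 - 2teY and 1 - c²x². Multiplying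
by (1 - 2teY)² = 1 - 4t²e² and using (1 - 2teY)(1 + Y²) = 1 - Y² leaves only rows, with coefficients
polynomial in x, 1/x, t and c. -/
theorem euler_row (j : ℕ) :
    (1 - 4 * PowerSeries.X ^ 2 * eSum ^ 2) * (1 - xPow 2 * scalar cSeries ^ 2) *
      euler (row (j + 1)) =
    ((j : BiSeries) + 1) * PowerSeries.X * eDiff * (1 - xPow 2 * scalar cSeries ^ 2) *
        (row j - row (j + 2)) +
      xPow 2 * scalar cSeries ^ 2 * (1 - 4 * PowerSeries.X ^ 2 * eSum ^ 2) * row (j + 1) := by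
  have h : euler (row (j + 1)) = kernelRoot ^ (j + 1) * euler (invRoot 2) +
      invRoot 2 * (((j : BiSeries) + 1) * kernelRoot ^ j * euler kernelRoot) := by
    rw [row]
    simp only [Derivation.leibniz, Derivation.leibniz_pow, smul_eq_mul, nsmul_eq_mul,
      Nat.add_sub_cancel]
    push_cast
    ring
  have hD : (1 - 2 * PowerSeries.X * eSum * kernelRoot) ^ 2 =
      1 - 4 * PowerSeries.X ^ 2 * eSum ^ 2 := by
    linear_combination -4 * PowerSeries.X * eSum * kernelRoot_eq
  have hD' : (1 - 2 * PowerSeries.X * eSum * kernelRoot) * (1 + kernelRoot ^ 2) =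
      1 - kernelRoot ^ 2 := by
    linear_combination 2 * kernelRoot * kernelRoot_eq
  have hY := euler_kernelRoot
  rw [h, ← hD]
  simp only [row]
  generalize hd : 1 - 2 * PowerSeries.X * eSum * kernelRoot = D at *
  linear_combination kernelRoot ^ (j + 1) * D ^ 2 * euler_invRoot +
    D * (1 - xPow 2 * scalar cSeries ^ 2) * invRoot 2 * ((j : BiSeries) + 1) * kernelRoot ^ j *
      hY +
    (1 - xPow 2 * scalar cSeries ^ 2) * invRoot 2 * ((j : BiSeries) + 1) * kernelRoot ^ j * PowerSeries.X *
      eDiff * hD'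

/-- Both `row_succ` and `euler_row` are linear in row j + 2, with coefficients carrying x² + 1 and
(x² - 1)(1 - c²x²) after multiplication by x. The Bézout identity (1 + 2c² - c²x²)(x² + 1) - (x² -
1)(1 - c²x²) = 2(1 + c²) combines them into a coefficient free of x, so row j + 2 is obtained
without dividing by a polynomial in x. -/
theorem row_add_two (j : ℕ) :
    2 * (1 + scalar cSeries ^ 2) * ((j : BiSeries) + 1) * PowerSeries.X * row (j + 2) =
      ((j : BiSeries) + 1) * (1 + 2 * scalar cSeries ^ 2 - scalar cSeries ^ 2 * xPow 2) * xPow 1 *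
        (row (j + 1) - PowerSeries.X * eSum * row j) -
      xPow 1 * (((j : BiSeries) + 1) * PowerSeries.X * eDiff * (1 - xPow 2 * scalar cSeries ^ 2) * row j +
        xPow 2 * scalar cSeries ^ 2 * (1 - 4 * PowerSeries.X ^ 2 * eSum ^ 2) * row (j + 1) -
        (1 - 4 * PowerSeries.X ^ 2 * eSum ^ 2) * (1 - xPow 2 * scalar cSeries ^ 2) *
          euler (row (j + 1))) := by
  have hx : xPow 2 = xPow 1 ^ 2 := by rw [sq, ← xPow_add]; rfl
  have hxy := xPow_mul_neg 1
  have h1 := row_succ j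
  rw [euler_row]
  have he : xPow 1 * eSum = xPow 2 + 1 := by rw [eSum, hx]; linear_combination hxy
  have hd : xPow 1 * eDiff = xPow 2 - 1 := by rw [eDiff, hx]; linear_combination -hxy
  linear_combination
    -((j : BiSeries) + 1) * (1 + 2 * scalar cSeries ^ 2 - scalar cSeries ^ 2 * xPow 2) * xPow 1 * h1
    - ((j : BiSeries) + 1) * (1 + 2 * scalar cSeries ^ 2 - scalar cSeries ^ 2 * xPow 2) * PowerSeries.X *
      row (j + 2) * he
    + ((j : BiSeries) + 1) * PowerSeries.X * (1 - xPow 2 * scalar cSeries ^ 2) * row (j + 2) * hd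

/-! ### Heights 0 and 1 -/

theorem two_mul_X_mul : 2 * PowerSeries.X * (1 + cSeries ^ 2) = cSeries := cSeries_eq.symm

theorem two_powerSeries_ne_zero : (2 : ℚ⟦X⟧) ≠ 0 := fun h => by
  have := congrArg PowerSeries.constantCoeff h
  rw [map_ofNat, map_zero] at this
  norm_num at this

theorem cSeries_ne_zero : cSeries ≠ 0 := by
  intro h
  have := cSeries_mul
  rw [h, zero_mul] at this
  exact mul_ne_zero two_powerSeries_ne_zero uSeries_ne_zero this.symm

theorem cSeries_mul_S_add (i : ℤ) : cSeries * (S (i - 1) 1 + S (i + 1) 1) =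
    (1 + cSeries ^ 2) * S i 0 - xCoeff i (root (-2)) := by
  have h := xCoeff_row_one_add i
  rw [two_mul_X_mul, xCoeff_row, xCoeff_row, xCoeff_row] at h
  exact_mod_cast h

theorem S_zero_zero : S 0 0 = 1 := by
  have := S_two_mul_zero 0
  simpa using this

theorem S_neg_zero (i : ℤ) (h : i < 0) : S i 0 = 0 := by
  have := xCoeff_row_zero_of_neg i h
  rw [xCoeff_row] at this
  exact_mod_cast this

theorem S_neg_one_add_S_one : S (-1) 1 + S 1 1 = cSeries := by
  have h := cSeries_mul_S_add 0
  have h0 := xCoeff_root 0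
  simp only [Nat.cast_zero, mul_zero, pow_zero, Ring.choose_zero_right, map_one, mul_one] at h0
  rw [h0, S_zero_zero] at h
  apply mul_left_cancel₀ cSeries_ne_zero
  simp only [zero_sub, zero_add] at h
  linear_combination h

theorem cSeries_mul_S_neg_add (k : ℕ) :
    cSeries * (S (-(2 * (k + 1 : ℕ) + 1)) 1 + S (-(2 * k + 1)) 1) =
      -(PowerSeries.C (Ring.choose (1 / 2 : ℚ) (k + 1)) * (-cSeries ^ 2) ^ (k + 1)) := by
  have h := cSeries_mul_S_add (-2 * (k + 1 : ℕ))
  rw [xCoeff_root, S_neg_zero _ (by push_cast; linarith)] at h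
  rw [show (-(2 * ((k + 1 : ℕ) : ℤ) + 1)) = -2 * (k + 1 : ℕ) - 1 by ring,
    show (-(2 * (k : ℤ) + 1)) = -2 * (k + 1 : ℕ) + 1 by push_cast; ring]
  linear_combination h

/-- Telescoping of the neighbour sums `cSeries_mul_S_neg_add` with alternating signs. The remainder
is a walk series with endpoint at distance 2K + 1, hence of high order in t. -/
theorem cSeries_mul_S_neg_one_eq_sum (K : ℕ) : cSeries * S (-1) 1 =
    ∑ k ∈ Finset.range K, PowerSeries.C (Ring.choose (1 / 2 : ℚ) (k + 1)) * (cSeries ^ 2) ^ (k + 1)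
      + (-1) ^ K * (cSeries * S (-(2 * K + 1)) 1) := by
  induction K with
  | zero => simp
  | succ K ih =>
    rw [ih, Finset.sum_range_succ]
    have h := cSeries_mul_S_neg_add K
    have h1 : ((-1) ^ K * (-1) ^ K : ℚ⟦X⟧) = 1 := by
      rw [← mul_pow]; simp
    rw [neg_pow] at h
    rw [pow_succ (-1 : ℚ⟦X⟧) K] at h ⊢
    linear_combination (-1) ^ K * h + (PowerSeries.C (Ring.choose (1 / 2 : ℚ) (K + 1)) *
      (cSeries ^ 2) ^ (K + 1)) * h1

/-- The series `√(1 + c²)`. -/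
def rhoSeries : ℚ⟦X⟧ := sqrtOneAdd.subst (cSeries ^ 2)

theorem hasSubst_cSeries_sq : PowerSeries.HasSubst (cSeries ^ 2) :=
  PowerSeries.HasSubst.of_constantCoeff_zero' (by simp [constantCoeff_cSeries])

theorem coeff_cSeries_pow_eq_zero (n d : ℕ) (h : n < d) :
    PowerSeries.coeff n ((cSeries ^ 2) ^ d) = 0 := by
  have h1 : PowerSeries.X ∣ cSeries ^ 2 := by
    rw [PowerSeries.X_dvd_iff]; simp [constantCoeff_cSeries]
  exact PowerSeries.X_pow_dvd_iff.1 (pow_dvd_pow_of_dvd h1 d) n h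

theorem cSeries_mul_S_neg_one : cSeries * S (-1) 1 = rhoSeries - 1 := by
  ext n
  -- Stopping at K = n suffices for the coefficient of tⁿ: the remainder is divisible by tⁿ⁺¹, and
  -- (c²)ᵈ does not contribute for d > n. The term d = 0 of the binomial series cancels the 1.
  rw [cSeries_mul_S_neg_one_eq_sum n, map_add, map_sum, rhoSeries, map_sub,
    PowerSeries.coeff_subst' hasSubst_cSeries_sq,
    finsum_eq_sum_of_support_subset (s := Finset.range (n + 1)), Finset.sum_range_succ']
  · have h : PowerSeries.coeff n ((-1) ^ n * (cSeries * S (-(2 * n + 1)) 1)) = 0 := by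
      have h1 : PowerSeries.X ^ (n + 1) ∣ S (-(2 * n + 1)) 1 := by
        rw [PowerSeries.X_pow_dvd_iff]
        intro m hm
        rw [S, PowerSeries.coeff_mk, a_eq_zero_of_lt, Nat.cast_zero]
        rw [abs_neg, abs_of_nonneg (by positivity)]
        omega
      exact PowerSeries.X_pow_dvd_iff.1 ((h1.mul_left _).mul_left _) n (by omega)
    rw [h]
    simp [sqrtOneAdd]
  · intro d hd
    rw [Finset.mem_coe, Finset.mem_range]
    by_contra hn
    apply hd
    simp only
    rw [coeff_cSeries_pow_eq_zero _ _ (by omega), smul_zero]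

theorem rhoSeries_mul : rhoSeries * (1 - uSeries ^ 2) = 1 + uSeries ^ 2 := by
  apply eq_of_sq_eq_sq_of_constantCoeff
  · rw [mul_pow, rhoSeries, ← PowerSeries.coe_substAlgHom hasSubst_cSeries_sq, ← map_pow,
      sqrtOneAdd_sq, map_add, map_one, PowerSeries.coe_substAlgHom,
      PowerSeries.subst_X hasSubst_cSeries_sq, one_add_cSeries_sq_mul]
  · have h : rhoSeries = 1 + cSeries * S (-1) 1 := by rw [cSeries_mul_S_neg_one]; ring
    simp [h, constantCoeff_uSeries, constantCoeff_cSeries]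
  · simp [constantCoeff_uSeries]

/-- √(1 + c²) - 1 = 2u²/(1 - u²) = cu, and c can be cancelled. -/
theorem S_neg_one_one : S (-1) 1 = uSeries := by
  apply mul_left_cancel₀ (mul_ne_zero two_powerSeries_ne_zero uSeries_ne_zero)
  linear_combination (1 - uSeries ^ 2) * cSeries_mul_S_neg_one + rhoSeries_mul -
    S (-1) 1 * cSeries_mul

theorem S_one_one : S 1 1 = cSeries - uSeries := by
  rw [← S_neg_one_one, ← S_neg_one_add_S_one]; ring

theorem S_neg_three_one : 2 * S (-3) 1 = cSeries - 2 * uSeries := by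
  have h := cSeries_mul_S_neg_add 0
  have hc : PowerSeries.C (Ring.choose (1 / 2 : ℚ) (0 + 1)) * 2 = 1 := by
    rw [zero_add, Ring.choose_one_right,
      show (2 : ℚ⟦X⟧) = PowerSeries.C 2 from (map_ofNat _ 2).symm, ← map_mul]
    norm_num
  norm_num at h hc
  rw [S_neg_one_one] at h
  apply mul_left_cancel₀ cSeries_ne_zero
  linear_combination 2 * h + cSeries ^ 2 * hc

theorem succ_mul_choose (r : ℚ) (k : ℕ) :
    ((k : ℚ) + 1) * Ring.choose r (k + 1) = Ring.choose r k * (r - k) := by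
  have h := Ring.choose_smul_choose r (Nat.le_succ k)
  rw [Nat.succ_sub (le_refl k), Nat.sub_self, Ring.choose_one_right, Nat.choose_succ_self_right,
    nsmul_eq_mul] at h
  exact_mod_cast h

theorem S_neg_five_one : 8 * S (-5) 1 = cSeries ^ 3 - 4 * cSeries + 8 * uSeries := by
  have h := cSeries_mul_S_neg_add 1
  have hc : PowerSeries.C (Ring.choose (1 / 2 : ℚ) (1 + 1)) * 8 = -1 := by
    have h2 : Ring.choose (1 / 2 : ℚ) 2 = -(1 / 8) := by
      have := succ_mul_choose (1 / 2) 1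
      rw [Ring.choose_one_right] at this
      norm_num at this ⊢
      linarith
    rw [one_add_one_eq_two, h2,
      show (8 : ℚ⟦X⟧) = PowerSeries.C 8 from (map_ofNat _ 8).symm, ← map_mul]
    norm_num
  norm_num at h hc
  apply mul_left_cancel₀ cSeries_ne_zero
  linear_combination 8 * h - 4 * cSeries * S_neg_three_one - cSeries ^ 4 * hc

/-! ### The relation for height `j + 2`, and the value of `S 0 2` -/

/-- The coefficient of xⁱ in `row_add_two`: powers of x become shifts of the abscissa, x d/dx
multiplies by the abscissa, and 2t(1 + c²) = c simplifies the leading factor. -/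
theorem S_add_two_relation (i : ℤ) (j : ℕ) :
    ((j : ℚ⟦X⟧) + 1) * (cSeries * S i (j + 2)) =
      -((j : ℚ⟦X⟧) + 1) * (2 * PowerSeries.X * (cSeries ^ 2 * S i j + (1 + cSeries ^ 2) * S (i - 2) j -
        cSeries ^ 2 * S (i - 4) j)) +
      (((j : ℚ⟦X⟧) + 1) * (1 + 2 * cSeries ^ 2) + 4 * PowerSeries.X ^ 2 * cSeries ^ 2 +
        ((i - 1 : ℤ) : ℚ⟦X⟧) * (1 - 8 * PowerSeries.X ^ 2 + 4 * PowerSeries.X ^ 2 * cSeries ^ 2)) *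
        S (i - 1) (j + 1) +
      (-((j : ℚ⟦X⟧) + 2) * cSeries ^ 2 + 8 * PowerSeries.X ^ 2 * cSeries ^ 2 -
        ((i - 3 : ℤ) : ℚ⟦X⟧) * (4 * PowerSeries.X ^ 2 +
          cSeries ^ 2 * (1 - 8 * PowerSeries.X ^ 2))) * S (i - 3) (j + 1) +
      (((i - 5 : ℤ) : ℚ⟦X⟧) + 1) * (4 * PowerSeries.X ^ 2 * cSeries ^ 2) * S (i - 5) (j + 1) -
      ((i + 1 : ℤ) : ℚ⟦X⟧) * (4 * PowerSeries.X ^ 2) * S (i + 1) (j + 1) := by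
  have hx2 : xPow 2 = xPow 1 ^ 2 := by rw [sq, ← xPow_add]; rfl
  have hx3 : xPow 3 = xPow 1 ^ 3 := by rw [pow_succ, ← hx2, ← xPow_add]; rfl
  have hx4 : xPow 4 = xPow 1 ^ 4 := by rw [pow_succ, ← hx3, ← xPow_add]; rfl
  have hx5 : xPow 5 = xPow 1 ^ 5 := by rw [pow_succ, ← hx4, ← xPow_add]; rfl
  have hxy := xPow_mul_neg 1
  have hc := congrArg scalar two_mul_X_mul
  have key : scalar (((j : ℚ⟦X⟧) + 1) * cSeries) * row (j + 2) =
      scalar (-((j : ℚ⟦X⟧) + 1) * (2 * PowerSeries.X)) * (scalar (cSeries ^ 2) * row j +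
        scalar (1 + cSeries ^ 2) * (xPow 2 * row j) - scalar (cSeries ^ 2) * (xPow 4 * row j)) +
      scalar (((j : ℚ⟦X⟧) + 1) * (1 + 2 * cSeries ^ 2) + 4 * PowerSeries.X ^ 2 * cSeries ^ 2) *
        (xPow 1 * row (j + 1)) +
      scalar (1 - 8 * PowerSeries.X ^ 2 + 4 * PowerSeries.X ^ 2 * cSeries ^ 2) *
        (xPow 1 * euler (row (j + 1))) +
      scalar (-((j : ℚ⟦X⟧) + 2) * cSeries ^ 2 + 8 * PowerSeries.X ^ 2 * cSeries ^ 2) *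
        (xPow 3 * row (j + 1)) -
      scalar (4 * PowerSeries.X ^ 2 + cSeries ^ 2 * (1 - 8 * PowerSeries.X ^ 2)) *
        (xPow 3 * euler (row (j + 1))) +
      scalar (4 * PowerSeries.X ^ 2 * cSeries ^ 2) * (xPow 5 * row (j + 1)) +
      scalar (4 * PowerSeries.X ^ 2 * cSeries ^ 2) * (xPow 5 * euler (row (j + 1))) -
      scalar (4 * PowerSeries.X ^ 2) * (xPow (-1) * euler (row (j + 1))) := by
    have h := row_add_two j
    have he : xPow 1 * eSum = xPow 1 ^ 2 + 1 := by rw [eSum]; linear_combination hxy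
    have hd : xPow 1 * eDiff = xPow 1 ^ 2 - 1 := by rw [eDiff]; linear_combination -hxy
    have he2 : xPow 1 * eSum ^ 2 = xPow 1 ^ 3 + 2 * xPow 1 + xPow (-1) := by
      rw [eSum]; linear_combination (2 * xPow 1 + xPow (-1)) * hxy
    have he3 : xPow 1 ^ 3 * eSum ^ 2 = xPow 1 ^ 5 + 2 * xPow 1 ^ 3 + xPow 1 := by
      rw [eSum]
      linear_combination (2 * xPow 1 ^ 3 + xPow 1 * (xPow 1 * xPow (-1) + 1)) * hxy
    simp only [map_add, map_mul, map_pow, map_sub, map_neg, scalar_X, map_one, map_ofNat,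
      map_natCast] at hc ⊢
    rw [hx2] at h ⊢
    rw [hx3, hx4, hx5]
    generalize scalar cSeries = c at *
    generalize euler (row (j + 1)) = r' at *
    generalize row (j + 1) = r1 at *
    generalize row (j + 2) = r2 at *
    generalize row j = r at *
    linear_combination h - ((j : BiSeries) + 1) * r2 * hc
      - ((j : BiSeries) + 1) * (1 + 2 * c ^ 2 - c ^ 2 * xPow 1 ^ 2) * PowerSeries.X * r * he
      - ((j : BiSeries) + 1) * PowerSeries.X * (1 - xPow 1 ^ 2 * c ^ 2) * r * hd
      + 4 * c ^ 2 * PowerSeries.X ^ 2 * r1 * he3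
      + 4 * PowerSeries.X ^ 2 * r' * (c ^ 2 * he3 - he2)
  have h := congrArg (xCoeff i) key
  simp only [map_add (xCoeff i), map_sub (xCoeff i), xCoeff_scalar_mul, xCoeff_xPow_mul, xCoeff_euler, xCoeff_row] at h
  simp only [sub_neg_eq_add] at h
  push_cast at h ⊢
  linear_combination h

theorem field_identity {K : Type*} [Field K] [CharZero K] {u c t s s₃ s₅ : K} (hu : u ≠ 0)
    (h1 : 1 - u ^ 2 ≠ 0) (h2 : 1 + u ^ 2 ≠ 0) (hc : c * (1 - u ^ 2) = 2 * u)
    (ht : t * (1 + u ^ 2) ^ 2 = u * (1 - u ^ 2)) (h3 : 2 * s₃ = c - 2 * u)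
    (h5 : 8 * s₅ = c ^ 3 - 4 * c + 8 * u)
    (h : c * s = -(2 * t * c ^ 2) + (1 + 2 * c ^ 2 + (8 * t ^ 2 - 1)) * u +
      (-(2 * c ^ 2) + 8 * t ^ 2 * c ^ 2 + 3 * (4 * t ^ 2 + c ^ 2 * (1 - 8 * t ^ 2))) * s₃ +
      -(4 * (4 * t ^ 2 * c ^ 2) * s₅) - 4 * t ^ 2 * (c - u)) :
    s * (1 - u ^ 2) = 2 * u ^ 2 := by
  have h3' : s₃ = (c - 2 * u) / 2 := by linear_combination h3 / 2
  have h5' : s₅ = (c ^ 3 - 4 * c + 8 * u) / 8 := by linear_combination h5 / 8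
  have hc' : c = 2 * u / (1 - u ^ 2) := by rw [eq_div_iff h1, hc]
  have ht' : t = u * (1 - u ^ 2) / (1 + u ^ 2) ^ 2 := by rw [eq_div_iff (pow_ne_zero _ h2), ht]
  subst h3' h5' hc' ht'
  have hc0 : 2 * u / (1 - u ^ 2) ≠ 0 := div_ne_zero (mul_ne_zero two_ne_zero hu) h1
  have hs : s = 2 * u ^ 2 / (1 - u ^ 2) := by
    apply mul_left_cancel₀ hc0
    rw [h]
    field_simp
    ring
  rw [hs, div_mul_cancel₀ _ h1]

/-- The relation at i = j = 0 involves only S_{0,0} at height 0 and the abscissae 1, -1, -3, -5 at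
height 1, all known; what remains is an identity of rational functions of u. -/
theorem S_zero_two : S 0 2 * (1 - uSeries ^ 2) = 2 * uSeries ^ 2 := by
  have h := S_add_two_relation 0 0
  norm_num [S_zero_zero, S_neg_one_one, S_one_one, S_neg_zero] at h
  have h3 := S_neg_three_one
  have h5 := S_neg_five_one

  apply FaithfulSMul.algebraMap_injective ℚ⟦X⟧ (FractionRing ℚ⟦X⟧)
  have hu := (map_ne_zero_iff _ (FaithfulSMul.algebraMap_injective ℚ⟦X⟧ (FractionRing ℚ⟦X⟧))).2
    uSeries_ne_zero
  have h1 := (map_ne_zero_iff _ (FaithfulSMul.algebraMap_injective ℚ⟦X⟧ (FractionRing ℚ⟦X⟧))).2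
    one_sub_uSeries_sq_ne_zero
  have h2 := (map_ne_zero_iff _ (FaithfulSMul.algebraMap_injective ℚ⟦X⟧ (FractionRing ℚ⟦X⟧))).2
    one_add_uSeries_sq_ne_zero
  apply_fun algebraMap ℚ⟦X⟧ (FractionRing ℚ⟦X⟧) at h h3 h5
  have hc := congrArg (algebraMap ℚ⟦X⟧ (FractionRing ℚ⟦X⟧)) cSeries_mul
  have hX := congrArg (algebraMap ℚ⟦X⟧ (FractionRing ℚ⟦X⟧)) X_mul_uSeries
  simp only [map_add, map_sub, map_neg, map_mul, map_pow, map_one, map_ofNat] at *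
  generalize algebraMap ℚ⟦X⟧ (FractionRing ℚ⟦X⟧) uSeries = u at *
  generalize algebraMap ℚ⟦X⟧ (FractionRing ℚ⟦X⟧) cSeries = c at *
  generalize algebraMap ℚ⟦X⟧ (FractionRing ℚ⟦X⟧) PowerSeries.X = t at *
  generalize algebraMap ℚ⟦X⟧ (FractionRing ℚ⟦X⟧) (S 0 2) = s at *
  generalize algebraMap ℚ⟦X⟧ (FractionRing ℚ⟦X⟧) (S (-3) 1) = s₃ at *
  generalize algebraMap ℚ⟦X⟧ (FractionRing ℚ⟦X⟧) (S (-5) 1) = s₅ at *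
  have : CharZero ℚ⟦X⟧ := algebraRat.charZero _
  have : CharZero (FractionRing ℚ⟦X⟧) := charZero_of_injective_algebraMap
    (FaithfulSMul.algebraMap_injective ℚ⟦X⟧ (FractionRing ℚ⟦X⟧))
  exact field_identity hu h1 h2 hc hX h3 h5 h

/-! ### Rationality in `u` with explicit bounds -/

/-- The denominator `u - u⁵ = u (1 - u²) (1 + u²)`. -/
def uDenom : ℚ⟦X⟧ := uSeries - uSeries ^ 5

/-- The series `P(u) / (u - u⁵)ᴺ` with `P` of degree at most `10 N`. -/
def uFilt (N : ℕ) : Submodule ℚ ℚ⟦X⟧ where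
  carrier := {f | ∃ P : Polynomial ℚ, P.natDegree ≤ 10 * N ∧
    uDenom ^ N * f = Polynomial.aeval uSeries P}
  zero_mem' := ⟨0, by simp, by simp⟩
  add_mem' := by
    rintro f g ⟨P, hP, h⟩ ⟨Q, hQ, h'⟩
    exact ⟨P + Q, Polynomial.natDegree_add_le_of_degree_le hP hQ, by rw [mul_add, h, h', map_add]⟩
  smul_mem' := by
    rintro r f ⟨P, hP, h⟩
    exact ⟨r • P, (Polynomial.natDegree_smul_le r P).trans hP, by rw [mul_smul_comm, h, map_smul]⟩

/-- Raising the exponent costs degree 5 in the numerator per unit, within the allowance of 10. The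
slope 10 is generous: 6 is what u itself takes at level 1. -/
theorem uFilt_mono {N M : ℕ} (h : N ≤ M) : uFilt N ≤ uFilt M := by
  rintro f ⟨P, hP, hf⟩
  obtain ⟨d, rfl⟩ := Nat.exists_eq_add_of_le h
  refine ⟨(Polynomial.X - Polynomial.X ^ 5) ^ d * P, ?_, ?_⟩
  · have h5 : (Polynomial.X - Polynomial.X ^ 5 : Polynomial ℚ).natDegree ≤ 5 := by compute_degree
    have := Polynomial.natDegree_mul_le_of_le (Polynomial.natDegree_pow_le_of_le d h5) hP
    omega
  · rw [map_mul, ← hf, pow_add, map_pow, map_sub, map_pow, Polynomial.aeval_X, uDenom]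
    ring

theorem mul_mem_uFilt {N M : ℕ} {f g : ℚ⟦X⟧} (hf : f ∈ uFilt N) (hg : g ∈ uFilt M) :
    f * g ∈ uFilt (N + M) := by
  obtain ⟨P, hP, h⟩ := hf
  obtain ⟨Q, hQ, h'⟩ := hg
  refine ⟨P * Q, ?_, ?_⟩
  · have := Polynomial.natDegree_mul_le_of_le hP hQ
    omega
  · rw [map_mul, ← h, ← h', pow_add]
    ring

/-- Division by a series s that divides a power of u - u⁵ with polynomial cofactor P(u). -/
theorem mem_uFilt_of_mul {N a : ℕ} {f s : ℚ⟦X⟧} {P : Polynomial ℚ} (hP : P.natDegree ≤ 10 * a)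
    (hs : uDenom ^ a = s * Polynomial.aeval uSeries P) (h : s * f ∈ uFilt N) :
    f ∈ uFilt (N + a) := by
  obtain ⟨Q, hQ, h⟩ := h
  refine ⟨Q * P, ?_, ?_⟩
  · have := Polynomial.natDegree_mul_le_of_le hQ hP
    omega
  · rw [map_mul, ← h, pow_add, hs]
    ring

theorem one_mem_uFilt : 1 ∈ uFilt 0 := ⟨1, by simp, by simp⟩

theorem X_mem_uFilt : (PowerSeries.X : ℚ⟦X⟧) ∈ uFilt 2 := by
  refine ⟨Polynomial.X ^ 3 * (1 - Polynomial.X ^ 2) ^ 3, by compute_degree!, ?_⟩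
  simp only [map_mul, map_pow, map_sub, map_one, Polynomial.aeval_X, uDenom]
  linear_combination uSeries ^ 2 * (1 - uSeries ^ 2) ^ 2 * X_mul_uSeries

theorem uSeries_mem_uFilt : uSeries ∈ uFilt 1 := by
  refine ⟨Polynomial.X ^ 2 - Polynomial.X ^ 6, by compute_degree!, ?_⟩
  simp only [map_pow, map_sub, Polynomial.aeval_X, uDenom]
  ring

theorem cSeries_mem_uFilt : cSeries ∈ uFilt 1 := by
  refine ⟨2 * Polynomial.X ^ 2 * (1 + Polynomial.X ^ 2), by compute_degree!, ?_⟩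
  simp only [map_mul, map_pow, map_add, map_one, map_ofNat, Polynomial.aeval_X, uDenom]
  linear_combination uSeries * (1 + uSeries ^ 2) * cSeries_mul

theorem mem_uFilt_of_cSeries_mul {N : ℕ} {f : ℚ⟦X⟧} (h : cSeries * f ∈ uFilt N) :
    f ∈ uFilt (N + 1) := by
  refine mem_uFilt_of_mul (P := Polynomial.C (1 / 2) * (1 - Polynomial.X ^ 2) ^ 2 *
    (1 + Polynomial.X ^ 2)) (by compute_degree!) ?_ h
  have hC : algebraMap ℚ ℚ⟦X⟧ (1 / 2) * 2 = 1 := by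
    rw [show (2 : ℚ⟦X⟧) = algebraMap ℚ ℚ⟦X⟧ 2 from (map_ofNat _ 2).symm, ← map_mul]
    norm_num
  simp only [map_mul, map_pow, map_add, map_sub, map_one, Polynomial.aeval_C, Polynomial.aeval_X,
    uDenom]
  linear_combination -(algebraMap ℚ ℚ⟦X⟧ (1 / 2)) * (1 - uSeries ^ 2) * (1 + uSeries ^ 2) *
    cSeries_mul - (uSeries - uSeries ^ 5) * hC

theorem pow_mem_uFilt {N : ℕ} {f : ℚ⟦X⟧} (h : f ∈ uFilt N) (k : ℕ) : f ^ k ∈ uFilt (N * k) := by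
  induction k with
  | zero => simpa using one_mem_uFilt
  | succ k ih =>
    rw [pow_succ]
    exact mul_mem_uFilt ih h

theorem intCast_mul_mem_uFilt {N : ℕ} {f : ℚ⟦X⟧} (h : f ∈ uFilt N) (m : ℤ) :
    (m : ℚ⟦X⟧) * f ∈ uFilt N := by
  rw [← zsmul_eq_mul]
  exact zsmul_mem h m

theorem C_mul_mem_uFilt {N : ℕ} {f : ℚ⟦X⟧} (h : f ∈ uFilt N) (r : ℚ) :
    PowerSeries.C r * f ∈ uFilt N := by
  rw [← PowerSeries.smul_eq_C_mul]
  exact (uFilt N).smul_mem r h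

theorem cSeries_sq_mem_uFilt : cSeries ^ 2 ∈ uFilt 2 := pow_mem_uFilt cSeries_mem_uFilt 2

theorem coeff_mul_pow_mem_uFilt (r : ℚ) (k : ℕ) :
    PowerSeries.C r * (-cSeries ^ 2) ^ k ∈ uFilt (2 * k) :=
  C_mul_mem_uFilt (pow_mem_uFilt (neg_mem cSeries_sq_mem_uFilt) k) r

theorem S_zero_mem_uFilt (i : ℤ) : S i 0 ∈ uFilt i.natAbs := by
  rcases lt_or_ge i 0 with h | h
  · rw [S_neg_zero i h]
    exact zero_mem _
  · rcases Int.even_or_odd' i with ⟨k, rfl | rfl⟩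
    · lift k to ℕ using by omega
      rw [S_two_mul_zero]
      exact uFilt_mono (by omega) (coeff_mul_pow_mem_uFilt _ _)
    · rw [S_eq_zero_of_odd _ _ ⟨k, by ring⟩]
      exact zero_mem _

theorem xCoeff_root_mem_uFilt (i : ℤ) : xCoeff i (root (-2)) ∈ uFilt i.natAbs := by
  by_cases h : ∃ k : ℕ, i = -2 * k
  · obtain ⟨k, rfl⟩ := h
    rw [xCoeff_root]
    exact uFilt_mono (by omega) (coeff_mul_pow_mem_uFilt _ _)
  · push Not at h
    rw [root, xCoeff_subst_of_ne _ constantCoeff_neg_cSeries_sq _ _ h]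
    exact zero_mem _

theorem S_one_add_mem_uFilt (i : ℤ) : S (i - 1) 1 + S (i + 1) 1 ∈ uFilt (i.natAbs + 3) := by
  apply mem_uFilt_of_cSeries_mul (N := i.natAbs + 2)
  rw [cSeries_mul_S_add]
  refine sub_mem ?_ (uFilt_mono (by omega) (xCoeff_root_mem_uFilt i))
  rw [add_comm i.natAbs]
  exact mul_mem_uFilt (add_mem (uFilt_mono (by omega) one_mem_uFilt) cSeries_sq_mem_uFilt)
    (S_zero_mem_uFilt i)

/-- Starting from S_{±1,1} (and 0 at abscissa 0), the neighbour sums propagate outwards in both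
directions; two consecutive abscissae are carried because each sum links i - 1 to i + 1. -/
theorem S_one_mem_uFilt (m : ℕ) :
    (S m 1 ∈ uFilt (m + 3) ∧ S (-m) 1 ∈ uFilt (m + 3)) ∧
      S (m + 1 : ℕ) 1 ∈ uFilt (m + 4) ∧ S (-(m + 1 : ℕ)) 1 ∈ uFilt (m + 4) := by
  induction m with
  | zero =>
    simp only [Nat.cast_zero, neg_zero, zero_add, Nat.cast_one, S_neg_one_one, S_one_one,
      S_eq_zero_of_odd 0 1 (by decide)]
    exact ⟨⟨zero_mem _, zero_mem _⟩,
      sub_mem (uFilt_mono (by omega) cSeries_mem_uFilt) (uFilt_mono (by omega) uSeries_mem_uFilt),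
      uFilt_mono (by omega) uSeries_mem_uFilt⟩
  | succ m ih =>
    refine ⟨ih.2, ?_, ?_⟩
    · have h1 := S_one_add_mem_uFilt (m + 1 : ℕ)
      have h2 := sub_mem (uFilt_mono (by omega) h1) (uFilt_mono (show m + 3 ≤ m + 5 by omega) ih.1.1)
      convert h2 using 1
      push_cast
      rw [add_sub_cancel_right]
      ring
    · have h1 := S_one_add_mem_uFilt (-(m + 1 : ℕ))
      have h2 := sub_mem (uFilt_mono (by omega) h1) (uFilt_mono (show m + 3 ≤ m + 5 by omega) ih.1.2)
      convert h2 using 1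
      push_cast
      rw [show -((m : ℤ) + 1) + 1 = -m by ring, show -((m : ℤ) + 1) - 1 = -(m + 1 + 1) by ring]
      ring

theorem S_one_mem_uFilt' (i : ℤ) : S i 1 ∈ uFilt (i.natAbs + 3) := by
  rcases Int.natAbs_eq i with h | h
  · rw [h, Int.natAbs_natCast]
    exact (S_one_mem_uFilt _).1.1
  · rw [h, Int.natAbs_neg, Int.natAbs_natCast]
    exact (S_one_mem_uFilt _).1.2

/-- The 12 per unit of height is 5 + 6 + 1: the relation reaches abscissae at distance at most 5,
its height j + 1 coefficients lie in level 6 (because of t²c²), and the division by c costs 1. -/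
theorem S_nat_mem_uFilt (j : ℕ) :
    (∀ i : ℤ, S i j ∈ uFilt (i.natAbs + 12 * j + 3)) ∧
      ∀ i : ℤ, S i (j + 1 : ℕ) ∈ uFilt (i.natAbs + 12 * (j + 1) + 3) := by
  induction j with
  | zero =>
    exact ⟨fun i => uFilt_mono (by omega) (S_zero_mem_uFilt i),
      fun i => uFilt_mono (by omega) (S_one_mem_uFilt' i)⟩
  | succ j ih =>
    refine ⟨ih.2, fun i => ?_⟩
    have hq := cSeries_sq_mem_uFilt
    have hX2 : PowerSeries.X ^ 2 ∈ uFilt 4 := pow_mem_uFilt X_mem_uFilt 2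
    have hXq : PowerSeries.X ^ 2 * cSeries ^ 2 ∈ uFilt 6 := mul_mem_uFilt hX2 hq
    have h0 (r : ℤ) (hr : r.natAbs ≤ i.natAbs + 5) :
        S r j ∈ uFilt (i.natAbs + 12 * j + 8) := uFilt_mono (by omega) (ih.1 r)
    have h1 (r : ℤ) (hr : r.natAbs ≤ i.natAbs + 5) :
        S r (j + 1) ∈ uFilt (i.natAbs + 12 * j + 20) := uFilt_mono (by omega) (ih.2 r)
    have hone : (1 : ℚ⟦X⟧) ∈ uFilt 6 := uFilt_mono (by omega) one_mem_uFilt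
    have hq6 := uFilt_mono (show 2 ≤ 6 by omega) hq
    have hX6 := uFilt_mono (show 4 ≤ 6 by omega) hX2
    have hint (f : ℚ⟦X⟧) (hf : f ∈ uFilt 6) (m : ℤ) : (m : ℚ⟦X⟧) * f ∈ uFilt 6 :=
      intCast_mul_mem_uFilt hf m
    have tail (f : ℚ⟦X⟧) {g : ℚ⟦X⟧} (hg : g ∈ uFilt (i.natAbs + 12 * j + 20)) (hf : f ∈ uFilt 6) :
        f * g ∈ uFilt (i.natAbs + 12 * j + 26) :=
      uFilt_mono (by omega) (mul_mem_uFilt hf hg)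
    have key : cSeries * S i (j + 2) ∈ uFilt (i.natAbs + 12 * j + 26) := by
      have h : ((j : ℚ⟦X⟧) + 1) * (cSeries * S i (j + 2)) ∈ uFilt (i.natAbs + 12 * j + 26) := by
        rw [S_add_two_relation]
        refine sub_mem (add_mem (add_mem (add_mem ?_ ?_) ?_) ?_) ?_
        · have e (f : ℚ⟦X⟧) : -((j : ℚ⟦X⟧) + 1) * (2 * PowerSeries.X * f) =
              ((-(j + 1) * 2 : ℤ) : ℚ⟦X⟧) * (PowerSeries.X * f) := by push_cast; ring
          rw [e]
          refine (intCast_mul_mem_uFilt (uFilt_mono (show 2 + (2 + (i.natAbs + 12 * j + 8)) ≤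
            i.natAbs + 12 * j + 26 by omega) (mul_mem_uFilt X_mem_uFilt ?_)) _)
          exact sub_mem (add_mem (mul_mem_uFilt hq (h0 _ (by omega)))
            (mul_mem_uFilt (add_mem (uFilt_mono (by omega) one_mem_uFilt) hq) (h0 _ (by omega))))
            (mul_mem_uFilt hq (h0 _ (by omega)))
        · refine tail _ (h1 _ (by omega)) ?_
          convert add_mem (add_mem (hint _ hone (j + 1 + (i - 1))) (hint _ hq6 (2 * (j + 1))))
            (add_mem (hint _ hXq (4 + 4 * (i - 1))) (hint _ hX6 (-8 * (i - 1)))) using 1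
          push_cast
          ring
        · refine tail _ (h1 _ (by omega)) ?_
          convert add_mem (add_mem (hint _ hq6 (-(j + 2) - (i - 3))) (hint _ hX6 (-4 * (i - 3))))
            (hint _ hXq (8 + 8 * (i - 3))) using 1
          push_cast
          ring
        · refine tail _ (h1 _ (by omega)) ?_
          convert hint _ hXq (4 * (i - 5 + 1)) using 1
          push_cast
          ring
        · refine tail _ (h1 _ (by omega)) ?_
          convert hint _ hX6 (4 * (i + 1)) using 1
          push_cast
          ring
      have h2 := (uFilt (i.natAbs + 12 * j + 26)).smul_mem ((j : ℚ) + 1)⁻¹ h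
      have hj : (j : ℚ) + 1 ≠ 0 := by positivity
      have h3 : ((j : ℚ⟦X⟧) + 1) * (cSeries * S i (j + 2)) =
          ((j : ℚ) + 1) • (cSeries * S i (j + 2)) := by
        rw [PowerSeries.smul_eq_C_mul]
        simp
      rwa [h3, smul_smul, inv_mul_cancel₀ hj, one_smul] at h2
    have h4 := mem_uFilt_of_cSeries_mul key
    refine uFilt_mono ?_ (by simpa [add_assoc] using h4)
    omega

theorem S_mem_uFilt (i j : ℤ) : S i j ∈ uFilt (i.natAbs + 12 * j.natAbs + 3) := by
  rcases Int.natAbs_eq j with h | h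
  · rw [h, Int.natAbs_natCast]
    exact (S_nat_mem_uFilt _).1 i
  · rw [h, S_neg, Int.natAbs_neg, Int.natAbs_natCast]
    exact (S_nat_mem_uFilt _).1 i

/-! ### Primitive recursiveness of integer and list arithmetic -/

theorem encode_int_ofNat (n : ℕ) : Encodable.encode (Int.ofNat n) = 2 * n := rfl

theorem encode_int_negSucc (n : ℕ) : Encodable.encode (Int.negSucc n) = 2 * n + 1 := rfl

theorem primrec_int_ofNat : Primrec Int.ofNat :=
  Primrec.encode_iff.1 ((Primrec.nat_mul.comp (Primrec.const 2) Primrec.id).of_eq fun _ => rfl)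

theorem primrec_int_negSucc : Primrec Int.negSucc :=
  Primrec.encode_iff.1 ((Primrec.succ.comp (Primrec.nat_mul.comp (Primrec.const 2) Primrec.id)).of_eq
    fun _ => rfl)

/-- The sign of an integer is the parity of its code, and halving the code recovers the absolute
value up to the shift of `Int.negSucc`. Sums and products are then computed from positive and
negative parts. -/
theorem primrec_int_toNat : Primrec Int.toNat := by
  refine (Primrec.ite (c := fun i : ℤ => Encodable.encode i % 2 = 0)
    (Primrec.eq.comp (Primrec.nat_mod.comp Primrec.encode (Primrec.const 2)) (Primrec.const 0))
    (Primrec.nat_div.comp Primrec.encode (Primrec.const 2)) (Primrec.const 0)).of_eq fun i => ?_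
  cases i with
  | ofNat n => rw [encode_int_ofNat, if_pos (by omega)]; simp
  | negSucc n => rw [encode_int_negSucc, if_neg (by omega)]; rfl

theorem primrec_int_neg_toNat : Primrec fun i : ℤ => (-i).toNat := by
  refine (Primrec.ite (c := fun i : ℤ => Encodable.encode i % 2 = 0)
    (Primrec.eq.comp (Primrec.nat_mod.comp Primrec.encode (Primrec.const 2)) (Primrec.const 0))
    (Primrec.const 0) (Primrec.succ.comp (Primrec.nat_div.comp Primrec.encode
      (Primrec.const 2)))).of_eq fun i => ?_
  cases i with
  | ofNat n => rw [encode_int_ofNat, if_pos (by omega)]; simp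
  | negSucc n =>
    rw [encode_int_negSucc, if_neg (by omega), show (2 * n + 1) / 2 = n by omega]
    rfl

theorem primrec_int_natSub : Primrec₂ fun m n : ℕ => (m : ℤ) - n := by
  refine (Primrec.ite (c := fun p : ℕ × ℕ => p.2 ≤ p.1)
    (Primrec.nat_le.comp Primrec.snd Primrec.fst)
    (primrec_int_ofNat.comp (Primrec.nat_sub.comp Primrec.fst Primrec.snd))
    (primrec_int_negSucc.comp (Primrec.pred.comp
      (Primrec.nat_sub.comp Primrec.snd Primrec.fst)))).of_eq fun p => ?_
  simp only [Int.ofNat_eq_natCast, Int.negSucc_eq, Nat.pred_eq_sub_one]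
  split_ifs <;> omega

theorem primrec_int_add : Primrec₂ fun i j : ℤ => i + j := by
  refine (primrec_int_natSub.comp
    (Primrec.nat_add.comp (primrec_int_toNat.comp Primrec.fst) (primrec_int_toNat.comp Primrec.snd))
    (Primrec.nat_add.comp (primrec_int_neg_toNat.comp Primrec.fst)
      (primrec_int_neg_toNat.comp Primrec.snd))).of_eq fun p => ?_
  push_cast
  linear_combination Int.toNat_sub_toNat_neg p.1 + Int.toNat_sub_toNat_neg p.2

theorem primrec_int_mul : Primrec₂ fun i j : ℤ => i * j := by
  have h1 := primrec_int_toNat.comp (Primrec.fst (α := ℤ) (β := ℤ))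
  have h2 := primrec_int_toNat.comp (Primrec.snd (α := ℤ) (β := ℤ))
  have h3 := primrec_int_neg_toNat.comp (Primrec.fst (α := ℤ) (β := ℤ))
  have h4 := primrec_int_neg_toNat.comp (Primrec.snd (α := ℤ) (β := ℤ))
  refine (primrec_int_natSub.comp
    (Primrec.nat_add.comp (Primrec.nat_mul.comp h1 h2) (Primrec.nat_mul.comp h3 h4))
    (Primrec.nat_add.comp (Primrec.nat_mul.comp h1 h4) (Primrec.nat_mul.comp h3 h2))).of_eq
      fun p => ?_
  conv_rhs => rw [← Int.toNat_sub_toNat_neg p.1, ← Int.toNat_sub_toNat_neg p.2]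
  push_cast
  ring

theorem primrec_int_natAbs : Primrec Int.natAbs :=
  (Primrec.nat_add.comp primrec_int_toNat primrec_int_neg_toNat).of_eq fun i => by omega

theorem primrec_int_list_sum : Primrec (List.sum : List ℤ → ℤ) := by
  refine (Primrec.list_foldr (f := fun l : List ℤ => l) (g := fun _ => (0 : ℤ))
    (h := fun _ p => p.1 + p.2) Primrec.id (Primrec.const 0)
    (primrec_int_add.comp (Primrec.fst.comp Primrec.snd) (Primrec.snd.comp Primrec.snd))).of_eq
      fun l => ?_
  rw [List.sum_eq_foldr]

/-- The truncated product of two power series, given by the lists of their coefficients. -/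
def listMul (D : ℕ) (l m : List ℤ) : List ℤ :=
  (List.range D).map fun n => ((List.range (n + 1)).map fun k => l.getD k 0 * m.getD (n - k) 0).sum

/-- The truncated power of a power series, given by the list of its coefficients. -/
def listPow (D : ℕ) (l : List ℤ) (n : ℕ) : List ℤ :=
  n.rec [1] fun _ r => listMul D r l

theorem primrec_listMul : Primrec fun p : ℕ × List ℤ × List ℤ => listMul p.1 p.2.1 p.2.2 := by
  refine Primrec.list_map (Primrec.list_range.comp Primrec.fst) (primrec_int_list_sum.comp
    (Primrec.list_map (Primrec.list_range.comp (Primrec.succ.comp Primrec.snd))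
      (primrec_int_mul.comp ?_ ?_)))
  · exact (Primrec.list_getD 0).comp
      (Primrec.fst.comp (Primrec.snd.comp (Primrec.fst.comp Primrec.fst))) Primrec.snd
  · exact (Primrec.list_getD 0).comp
      (Primrec.snd.comp (Primrec.snd.comp (Primrec.fst.comp Primrec.fst)))
      (Primrec.nat_sub.comp (Primrec.snd.comp Primrec.fst) Primrec.snd)

theorem primrec_listPow : Primrec fun p : ℕ × List ℤ × ℕ => listPow p.1 p.2.1 p.2.2 := by
  refine Primrec.nat_rec' (f := fun p : ℕ × List ℤ × ℕ => p.2.2) (g := fun _ => [1])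
    (h := fun p q => listMul p.1 q.2 p.2.1) (Primrec.snd.comp Primrec.snd) (Primrec.const _)
    (primrec_listMul.comp (Primrec.pair (Primrec.fst.comp Primrec.fst)
      (Primrec.pair (Primrec.snd.comp Primrec.snd)
        (Primrec.fst.comp (Primrec.snd.comp Primrec.fst)))))

/-- The first `D` terms of `l` are the coefficients of `f`. -/
def Approximates (D : ℕ) (l : List ℤ) (f : ℤ⟦X⟧) : Prop :=
  ∀ n < D, l.getD n 0 = PowerSeries.coeff n f

theorem getD_map_range {α : Type*} (D : ℕ) (f : ℕ → α) (n : ℕ) (h : n < D) (d : α) :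
    ((List.range D).map f).getD n d = f n := by
  rw [List.getD_eq_getElem _ _ (by simpa using h)]
  simp

theorem sum_map_range {R : Type*} [AddCommMonoid R] (n : ℕ) (f : ℕ → R) :
    ((List.range n).map f).sum = ∑ k ∈ Finset.range n, f k := by
  induction n with
  | zero => simp
  | succ n ih => rw [List.range_succ, List.map_append, List.sum_append, ih, Finset.sum_range_succ]; simp

theorem approximates_listMul {D : ℕ} {l m : List ℤ} {f g : ℤ⟦X⟧} (hl : Approximates D l f)
    (hm : Approximates D m g) : Approximates D (listMul D l m) (f * g) := by
  intro n hn
  rw [listMul, getD_map_range _ _ _ hn, PowerSeries.coeff_mul, sum_map_range,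
    Finset.Nat.sum_antidiagonal_eq_sum_range_succ_mk]
  refine Finset.sum_congr rfl fun k hk => ?_
  rw [Finset.mem_range] at hk
  rw [hl k (by omega), hm (n - k) (by omega)]

theorem approximates_listPow {D : ℕ} {l : List ℤ} {f : ℤ⟦X⟧} (hl : Approximates D l f) (n : ℕ) :
    Approximates D (listPow D l n) (f ^ n) := by
  induction n with
  | zero =>
    intro n _
    rw [pow_zero, PowerSeries.coeff_one]
    cases n <;> simp [listPow]
  | succ n ih =>
    rw [pow_succ]
    exact approximates_listMul ih hl

/-! ### Computable enumeration of the walks -/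

/-- The endpoints of the walks of length `n` on the slit plane, with multiplicity. -/
def endpoints (n : ℕ) : List (ℤ × ℤ) :=
  n.rec [(0, 0)] fun _ l => l.flatMap fun p =>
    [((1 : ℤ), (1 : ℤ)), (1, -1), (-1, 1), (-1, -1)].flatMap fun s =>
      if (p.1 + s.1).toNat = 0 ∧ (p.2 + s.2) = 0 then [] else [(p.1 + s.1, p.2 + s.2)]

theorem primrec_endpoints : Primrec endpoints := by
  refine Primrec.nat_rec₁ [(0, 0)] (Primrec.list_flatMap Primrec.snd
    (Primrec.list_flatMap (Primrec.const _) ?_))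
  have h1 : Primrec fun q : ((ℕ × List (ℤ × ℤ)) × ℤ × ℤ) × ℤ × ℤ => q.1.2.1 + q.2.1 :=
    primrec_int_add.comp (Primrec.fst.comp (Primrec.snd.comp Primrec.fst))
      (Primrec.fst.comp Primrec.snd)
  have h2 : Primrec fun q : ((ℕ × List (ℤ × ℤ)) × ℤ × ℤ) × ℤ × ℤ => q.1.2.2 + q.2.2 :=
    primrec_int_add.comp (Primrec.snd.comp (Primrec.snd.comp Primrec.fst))
      (Primrec.snd.comp Primrec.snd)
  exact Primrec.ite ((Primrec.eq.comp (primrec_int_toNat.comp h1) (Primrec.const 0)).and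
    (Primrec.eq.comp h2 (Primrec.const 0))) (Primrec.const [])
    (Primrec.list_cons.comp (Primrec.pair h1 h2) (Primrec.const []))

/-- The test `toNat = 0` is x + s ≤ 0, phrased by a function already known to be primitive
recursive. -/
theorem count_step (i j x y s r : ℤ) :
    List.count (i, j) (if (x + s).toNat = 0 ∧ y + r = 0 then [] else [(x + s, y + r)]) =
      if i ≤ 0 ∧ j = 0 then 0 else if (x, y) = (i - s, j - r) then 1 else 0 := by
  split_ifs with h1 h2 h3 h2 h3
  · rfl
  · rw [Prod.mk.injEq] at h3
    omega
  · rfl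
  · rw [List.count_eq_zero, List.mem_singleton, Prod.mk.injEq]
    omega
  · rw [Prod.mk.injEq] at h3
    rw [h3.1, h3.2]
    simp
  · rw [List.count_eq_zero, List.mem_singleton, Prod.mk.injEq]
    rw [Prod.mk.injEq] at h3
    omega

theorem count_flatMap_step (l : List (ℤ × ℤ)) (i j : ℤ) :
    List.count (i, j) (l.flatMap fun p =>
      [((1 : ℤ), (1 : ℤ)), (1, -1), (-1, 1), (-1, -1)].flatMap fun s =>
        if (p.1 + s.1).toNat = 0 ∧ (p.2 + s.2) = 0 then [] else [(p.1 + s.1, p.2 + s.2)]) =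
      if i ≤ 0 ∧ j = 0 then 0 else l.count (i - 1, j - 1) + l.count (i - 1, j + 1) +
        l.count (i + 1, j - 1) + l.count (i + 1, j + 1) := by
  induction l with
  | nil => simp
  | cons p l ih =>
    obtain ⟨x, y⟩ := p
    rw [List.flatMap_cons, List.count_append, ih]
    simp only [List.flatMap_cons, List.flatMap_nil, List.count_append, List.append_nil, count_step,
      List.count_cons, sub_neg_eq_add, beq_iff_eq]
    split_ifs <;> omega

theorem count_endpoints (n : ℕ) (i j : ℤ) : (endpoints n).count (i, j) = a i j n := by
  induction n generalizing i j with
  | zero =>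
    rw [a_zero, show endpoints 0 = [(0, 0)] from rfl, List.count_singleton]
    simp only [beq_iff_eq, Prod.mk.injEq, @eq_comm ℤ 0]
  | succ n ih =>
    refine (count_flatMap_step (endpoints n) i j).trans ?_
    split_ifs with h
    · rw [a_succ_of_mem i j n h]
    · rw [a_succ i j n h, ih, ih, ih, ih]

/-- The number of walks of length `n` ending at `p`, as an integer. -/
def walkCount (p : ℤ × ℤ) (n : ℕ) : ℤ :=
  ((endpoints n).map fun r => if r = p then (1 : ℤ) else 0).sum

theorem walkCount_eq (i j : ℤ) (n : ℕ) : walkCount (i, j) n = a i j n := by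
  rw [← count_endpoints, walkCount]
  induction endpoints n with
  | nil => rfl
  | cons r l ih =>
    rw [List.map_cons, List.sum_cons, ih, List.count_cons]
    by_cases h : r = (i, j) <;> simp [h, add_comm]

theorem primrec_walkCount : Primrec₂ walkCount :=
  primrec_int_list_sum.comp (Primrec.list_map (primrec_endpoints.comp Primrec.snd)
    (Primrec.ite (Primrec.eq.comp Primrec.snd (Primrec.fst.comp Primrec.fst))
      (Primrec.const 1) (Primrec.const 0)))

/-! ### The numerator and denominator returned by the algorithm -/

/-- The coefficients of `z - z⁵`. -/
def denomList : List ℤ := [0, 1, 0, 0, 0, -1]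

/-- The first coefficients of `t = z (1 - z²) / (1 + z²)²`. -/
def tauList (D : ℕ) : List ℤ :=
  -- The subtractions of 0 and from 0 put both signs in the form handled by `primrec_int_natSub`.
  (List.range D).map fun m : ℕ => if m % 4 = 1 then (m : ℤ) - (0 : ℕ)
    else if m % 4 = 3 then ((0 : ℕ) : ℤ) - m else 0

/-- The exponent of the denominator for the endpoint `p`. -/
def denomExponent (p : ℤ × ℤ) : ℕ := p.1.natAbs + 12 * p.2.natAbs + 3

/-- The denominator of the generating function for the endpoint `p`. -/
def denominator (p : ℤ × ℤ) : List ℤ :=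
  listPow (10 * denomExponent p + 1) denomList (denomExponent p)

/-- The numerator of the generating function for the endpoint `p`. -/
def numerator (p : ℤ × ℤ) : List ℤ :=
  (List.range (10 * denomExponent p + 1)).map fun m =>
    ((List.range (m + 1)).map fun n => walkCount p n *
      (listMul (10 * denomExponent p + 1) (listPow (10 * denomExponent p + 1)
        (tauList (10 * denomExponent p + 1)) n) (denominator p)).getD m 0).sum

theorem primrec_denomExponent : Primrec denomExponent :=
  Primrec.nat_add.comp (Primrec.nat_add.comp (primrec_int_natAbs.comp Primrec.fst)
    (Primrec.nat_mul.comp (Primrec.const 12) (primrec_int_natAbs.comp Primrec.snd)))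
    (Primrec.const 3)

theorem primrec_degreeBound : Primrec fun p => 10 * denomExponent p + 1 :=
  Primrec.succ.comp (Primrec.nat_mul.comp (Primrec.const 10) primrec_denomExponent)

theorem primrec_tauList : Primrec tauList := by
  have hm := Primrec.nat_mod.comp (Primrec.snd (α := ℕ) (β := ℕ)) (Primrec.const 4)
  exact Primrec.list_map Primrec.list_range (Primrec.ite (Primrec.eq.comp hm (Primrec.const 1))
    (primrec_int_natSub.comp Primrec.snd (Primrec.const 0))
    (Primrec.ite (Primrec.eq.comp hm (Primrec.const 3))
      (primrec_int_natSub.comp (Primrec.const 0) Primrec.snd) (Primrec.const 0)))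

theorem primrec_denominator : Primrec denominator :=
  primrec_listPow.comp (Primrec.pair primrec_degreeBound
    (Primrec.pair (Primrec.const _) primrec_denomExponent))

theorem primrec_numerator : Primrec numerator := by
  refine Primrec.list_map (Primrec.list_range.comp primrec_degreeBound)
    (primrec_int_list_sum.comp (Primrec.list_map
      (Primrec.list_range.comp (Primrec.succ.comp Primrec.snd)) (primrec_int_mul.comp
        (primrec_walkCount.comp (Primrec.fst.comp Primrec.fst) Primrec.snd)
        ((Primrec.list_getD 0).comp (primrec_listMul.comp (Primrec.pair ?_ (Primrec.pair
          (primrec_listPow.comp (Primrec.pair ?_ (Primrec.pair (primrec_tauList.comp ?_)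
            Primrec.snd))) (primrec_denominator.comp (Primrec.fst.comp Primrec.fst)))))
          (Primrec.snd.comp Primrec.fst))))) <;>
  exact primrec_degreeBound.comp (Primrec.fst.comp Primrec.fst)

theorem polyEval_cons (c : ℤ) (l : List ℤ) (x : ℚ⸨X⸩) :
    polyEval (c :: l) x = (c : ℚ⸨X⸩) + x * polyEval l x := by
  simp [polyEval]

theorem polyEval_eq_sum (l : List ℤ) (x : ℚ⸨X⸩) (D : ℕ) (h : l.length ≤ D) :
    polyEval l x = ∑ k ∈ Finset.range D, (l.getD k 0 : ℚ⸨X⸩) * x ^ k := by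
  induction l generalizing D with
  | nil => simp [polyEval]
  | cons c l ih =>
    obtain ⟨D, rfl⟩ : ∃ d, D = d + 1 := ⟨D - 1, by simp at h; omega⟩
    have h' := ih D (by simpa using h)
    rw [polyEval_cons, h', Finset.sum_range_succ', Finset.mul_sum, add_comm]
    congr 1
    · refine Finset.sum_congr rfl fun k _ => ?_
      rw [List.getD_cons_succ]
      ring
    · simp

theorem length_listPow_le (D : ℕ) (hD : 1 ≤ D) (l : List ℤ) (n : ℕ) :
    (listPow D l n).length ≤ D := by
  cases n with
  | zero => simpa [listPow] using hD
  | succ n => simp [listPow, listMul]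

/-- The polynomial `z - z⁵`. -/
def denomPoly : Polynomial ℤ := Polynomial.X - Polynomial.X ^ 5

theorem approximates_denomList (D : ℕ) : Approximates D denomList (denomPoly : ℤ⟦X⟧) := by
  intro n _
  rw [Polynomial.coeff_coe, denomPoly, Polynomial.coeff_sub, Polynomial.coeff_X,
    Polynomial.coeff_X_pow]
  match n with
  | 0 | 1 | 2 | 3 | 4 | 5 => simp [denomList]
  | n + 6 => simp [denomList]

theorem polyEval_denominator (p : ℤ × ℤ) (x : ℚ⸨X⸩) :
    polyEval (denominator p) x = (x - x ^ 5) ^ denomExponent p := by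
  rw [denominator, polyEval_eq_sum _ _ _ (length_listPow_le _ (by omega) _ _)]
  have h : (denomPoly ^ denomExponent p).natDegree < 10 * denomExponent p + 1 := by
    have h5 : denomPoly.natDegree ≤ 5 := by rw [denomPoly]; compute_degree
    have := Polynomial.natDegree_pow_le_of_le (denomExponent p) h5
    omega
  have h1 := Polynomial.aeval_eq_sum_range' h x
  rw [map_pow, denomPoly, map_sub, map_pow, Polynomial.aeval_X, ← denomPoly] at h1
  rw [h1]
  refine Finset.sum_congr rfl fun k hk => ?_
  rw [approximates_listPow (approximates_denomList _) _ k (Finset.mem_range.1 hk),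
    ← Polynomial.coe_pow, Polynomial.coeff_coe, Algebra.smul_def, eq_intCast]

/-! ### Inversion of `u` and correctness of the algorithm -/

/-- The series `t = z (1 - z²) / (1 + z²)²`, the reciprocal of `u`. -/
def tauSeries : ℤ⟦X⟧ := PowerSeries.mk fun m =>
  if m % 4 = 1 then (m : ℤ) else if m % 4 = 3 then -(m : ℤ) else 0

theorem tauSeries_mul : tauSeries * (1 + PowerSeries.X ^ 2) ^ 2 =
    PowerSeries.X * (1 - PowerSeries.X ^ 2) := by
  have h : tauSeries * (1 + PowerSeries.X ^ 2) ^ 2 = tauSeries +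
      2 * (tauSeries * PowerSeries.X ^ 2) + tauSeries * PowerSeries.X ^ 4 := by ring
  have h' : (PowerSeries.X : ℤ⟦X⟧) * (1 - PowerSeries.X ^ 2) =
    PowerSeries.X ^ 1 - PowerSeries.X ^ 3 := by ring
  rw [h, h', two_mul]
  ext n
  simp only [map_add, map_sub, PowerSeries.coeff_mul_X_pow', PowerSeries.coeff_X_pow, tauSeries,
    PowerSeries.coeff_mk]
  split_ifs <;> omega

/-- The series `tauSeries`, with rational coefficients. -/
def tauRat : ℚ⟦X⟧ := PowerSeries.map (Int.castRingHom ℚ) tauSeries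

theorem tauRat_mul : tauRat * (1 + PowerSeries.X ^ 2) ^ 2 =
    PowerSeries.X * (1 - PowerSeries.X ^ 2) := by
  have h := congrArg (PowerSeries.map (Int.castRingHom ℚ)) tauSeries_mul
  simp only [map_mul, map_add, map_sub, map_pow, map_one, PowerSeries.map_X] at h
  exact h

theorem X_dvd_tauRat : PowerSeries.X ∣ tauRat := by
  rw [PowerSeries.X_dvd_iff, ← PowerSeries.coeff_zero_eq_constantCoeff_apply, tauRat,
    PowerSeries.coeff_map, tauSeries, PowerSeries.coeff_mk]
  simp

theorem hasSubst_tauRat : PowerSeries.HasSubst tauRat :=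
  PowerSeries.HasSubst.of_constantCoeff_zero' (PowerSeries.X_dvd_iff.1 X_dvd_tauRat)

/-- The substitution `t = z (1 - z²) / (1 + z²)²`. -/
def tauSubst : ℚ⟦X⟧ →ₐ[ℚ] ℚ⟦X⟧ := PowerSeries.substAlgHom hasSubst_tauRat

theorem tauSubst_X : tauSubst PowerSeries.X = tauRat := PowerSeries.substAlgHom_X _

/-- Both U = u(t(z)) and z solve t(z)(1 + w²)² = w(1 - w²). The difference of the two equations
factors as U - z times a series of constant term 1. -/
theorem tauSubst_uSeries : tauSubst uSeries = PowerSeries.X := by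
  have h0 : PowerSeries.constantCoeff (tauSubst uSeries) = 0 := by
    rw [tauSubst, PowerSeries.coe_substAlgHom]
    exact PowerSeries.constantCoeff_subst_eq_zero (PowerSeries.X_dvd_iff.1 X_dvd_tauRat) _
      constantCoeff_uSeries
  have h := congrArg tauSubst X_mul_uSeries
  simp only [map_mul, map_add, map_sub, map_pow, map_one, tauSubst_X] at h
  have h1 : (tauSubst uSeries - PowerSeries.X) * ((1 + tauSubst uSeries * PowerSeries.X) *
      (1 - tauSubst uSeries - PowerSeries.X - tauSubst uSeries * PowerSeries.X) *
      (1 + tauSubst uSeries + PowerSeries.X - tauSubst uSeries * PowerSeries.X)) = 0 := by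
    linear_combination (1 + tauSubst uSeries ^ 2) ^ 2 * tauRat_mul -
      (1 + PowerSeries.X ^ 2) ^ 2 * h
  rcases mul_eq_zero.1 h1 with h1 | h1
  · exact sub_eq_zero.1 h1
  · exact absurd h1 (ne_zero_of_constantCoeff_eq_one (by simp [h0]))

/-- Since t(z) is divisible by z, only the terms of f of degree at most m reach the coefficient of
zᵐ: finitely many walk lengths suffice. -/
theorem coeff_mul_tauSubst (f g : ℚ⟦X⟧) (m : ℕ) :
    PowerSeries.coeff m (tauSubst f * g) =
      ∑ n ∈ Finset.range (m + 1), PowerSeries.coeff n f * PowerSeries.coeff m (tauRat ^ n * g) := by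
  conv_lhs => rw [PowerSeries.eq_X_pow_mul_shift_add_trunc (m + 1) f]
  rw [map_add tauSubst, map_mul tauSubst, map_pow, tauSubst_X, add_mul, map_add, mul_assoc,
    PowerSeries.X_pow_dvd_iff.1 ((pow_dvd_pow_of_dvd X_dvd_tauRat (m + 1)).mul_right _) m
      (Nat.lt_succ_self m), zero_add, tauSubst, PowerSeries.substAlgHom_coe,
    Polynomial.aeval_eq_sum_range' (PowerSeries.natDegree_trunc_lt f m), Finset.sum_mul, map_sum]
  refine Finset.sum_congr rfl fun n hn => ?_
  rw [smul_mul_assoc, PowerSeries.coeff_smul, PowerSeries.coeff_trunc,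
    if_pos (Finset.mem_range.1 hn)]
  rfl

theorem approximates_tauList (D : ℕ) : Approximates D (tauList D) tauSeries := by
  intro n hn
  rw [tauList, getD_map_range _ _ _ hn, tauSeries, PowerSeries.coeff_mk]
  simp

theorem numerator_getD (i j : ℤ) (m : ℕ) (hm : m < 10 * denomExponent (i, j) + 1) :
    ((numerator (i, j)).getD m 0 : ℚ) = PowerSeries.coeff m (tauSubst (S i j) *
      (PowerSeries.X - PowerSeries.X ^ 5) ^ denomExponent (i, j)) := by
  rw [coeff_mul_tauSubst, numerator, getD_map_range _ _ _ hm, sum_map_range]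
  push_cast
  refine Finset.sum_congr rfl fun n _ => ?_
  have h := approximates_listMul (approximates_listPow (approximates_tauList _) n)
    (approximates_listPow (approximates_denomList _) (denomExponent (i, j))) m hm
  rw [walkCount_eq, denominator, h, S, PowerSeries.coeff_mk, tauRat, Int.cast_natCast,
    ← eq_intCast (Int.castRingHom ℚ), ← PowerSeries.coeff_map]
  simp only [map_mul, map_pow, denomPoly, Polynomial.coe_sub, Polynomial.coe_pow, Polynomial.coe_X,
    map_sub, PowerSeries.map_X]

/-- `u` as a Laurent series is the power series `uSeries`. -/
theorem u_eq : u = (uSeries : ℚ⸨X⸩) := by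
  have h := congrArg (HahnSeries.ofPowerSeries ℤ ℚ) uSeries_mul
  have h0 : rMinus + 1 ≠ 0 := by
    intro h
    have h1 : HahnSeries.ofPowerSeries ℤ ℚ (sqrtSeries (-4) + 1) = 0 := by
      rw [map_add, map_one]; exact h
    rw [map_eq_zero_iff _ HahnSeries.ofPowerSeries_injective] at h1
    have := congrArg PowerSeries.constantCoeff h1
    rw [map_add, constantCoeff_sqrtSeries] at this
    norm_num at this
  rw [u, div_eq_iff h0]
  simp only [map_mul, map_add, map_sub, map_one] at h
  exact h.symm

theorem uDenom_ne_zero : uDenom ≠ 0 := by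
  have : uDenom = uSeries * (1 - uSeries ^ 2) * (1 + uSeries ^ 2) := by rw [uDenom]; ring
  rw [this]
  exact mul_ne_zero (mul_ne_zero uSeries_ne_zero one_sub_uSeries_sq_ne_zero)
    one_add_uSeries_sq_ne_zero

theorem u_sub_pow_ne_zero (n : ℕ) : (u - u ^ 5) ^ n ≠ 0 := by
  apply pow_ne_zero
  rw [u_eq]
  have := (map_ne_zero_iff (HahnSeries.ofPowerSeries ℤ ℚ) HahnSeries.ofPowerSeries_injective).2
    uDenom_ne_zero
  rwa [uDenom, map_sub, map_pow] at this

/-- `S_mem_uFilt` gives (u - u⁵)ᴺ S = P(u) with deg P ≤ 10N, and substituting t = t(z) turns it into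
(z - z⁵)ᴺ S(t(z)) = P(z). The computed list, truncated beyond degree 10N, is thus the whole of P,
which in particular has integer coefficients. -/
theorem polyEval_numerator (i j : ℤ) : polyEval (numerator (i, j)) u =
    (u - u ^ 5) ^ denomExponent (i, j) * (S i j : ℚ⸨X⸩) := by
  obtain ⟨P, hP, h⟩ := S_mem_uFilt i j
  have hP' : P.natDegree < 10 * denomExponent (i, j) + 1 := Nat.lt_succ_of_le hP
  have hc (m : ℕ) (hm : m < 10 * denomExponent (i, j) + 1) :
      ((numerator (i, j)).getD m 0 : ℚ) = P.coeff m := by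
    have h1 := congrArg tauSubst h
    rw [map_mul, map_pow, uDenom, map_sub, map_pow, tauSubst_uSeries,
      ← Polynomial.aeval_algHom_apply, tauSubst_uSeries] at h1
    rw [numerator_getD i j m hm, mul_comm, denomExponent, h1]
    rw [← Polynomial.coeff_coe, ← PowerSeries.substAlgHom_coe PowerSeries.HasSubst.X',
      PowerSeries.coe_substAlgHom, PowerSeries.X_subst]
  rw [polyEval_eq_sum _ _ (10 * denomExponent (i, j) + 1) (by simp [numerator])]
  have h2 := congrArg (HahnSeries.ofPowerSeries ℤ ℚ) h
  rw [Polynomial.aeval_eq_sum_range' hP', map_sum, map_mul, map_pow, uDenom, map_sub, map_pow] at h2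
  rw [u_eq]
  refine Eq.trans ?_ h2.symm
  refine Finset.sum_congr rfl fun k hk => ?_
  rw [PowerSeries.smul_eq_C_mul, map_mul, map_pow, ← hc k (Finset.mem_range.1 hk)]
  congr 1
  simp

/-! ### Closed forms and Catalan coefficients -/

theorem four_powerSeries_ne_zero : (4 : ℚ⟦X⟧) ≠ 0 := fun h => by
  have := congrArg PowerSeries.constantCoeff h
  rw [map_ofNat, map_zero] at this
  norm_num at this

theorem S_one_one_mul : S 1 1 * (1 - uSeries ^ 2) = uSeries * (1 + uSeries ^ 2) := by
  rw [S_one_one]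
  linear_combination cSeries_mul

theorem four_X_mul_S_one_one :
    4 * PowerSeries.X * S 1 1 = 2 - sqrtSeries (-4) - sqrtSeries 4 := by
  apply mul_right_cancel₀ (mul_ne_zero one_add_uSeries_sq_ne_zero one_sub_uSeries_sq_ne_zero)
  linear_combination 4 * PowerSeries.X * (1 + uSeries ^ 2) * S_one_one_mul +
    4 * uSeries * X_mul_uSeries + (1 - uSeries ^ 2) * (sqrtSeries_neg_four_mul + sqrtSeries_four_mul)

theorem four_X_mul_S_zero_two :
    4 * PowerSeries.X * S 0 2 = sqrtSeries 4 - sqrtSeries (-4) - 4 * PowerSeries.X := by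
  apply mul_right_cancel₀ (mul_ne_zero one_add_uSeries_sq_ne_zero one_sub_uSeries_sq_ne_zero)
  linear_combination 4 * PowerSeries.X * (1 + uSeries ^ 2) * S_zero_two +
    4 * X_mul_uSeries + (1 - uSeries ^ 2) * (sqrtSeries_neg_four_mul - sqrtSeries_four_mul)

/-- √(1 - 4t) = 1 - 2tC(t) and √(1 + 4t) = 1 + 2tC(-t), so S_{1,1} is the odd part of C, as S_{0,2}
is its even part without constant term. -/
theorem two_mul_S_one_one : 2 * S 1 1 = catalanGF - PowerSeries.rescale (-1) catalanGF := by
  apply mul_left_cancel₀ (mul_ne_zero two_powerSeries_ne_zero PowerSeries.X_ne_zero)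
  linear_combination four_X_mul_S_one_one - sqrtSeries_neg_four - sqrtSeries_four

theorem two_mul_S_zero_two : 2 * S 0 2 = catalanGF + PowerSeries.rescale (-1) catalanGF - 2 := by
  apply mul_left_cancel₀ (mul_ne_zero two_powerSeries_ne_zero PowerSeries.X_ne_zero)
  linear_combination four_X_mul_S_zero_two - sqrtSeries_neg_four + sqrtSeries_four

theorem coeff_two_mul (f : ℚ⟦X⟧) (n : ℕ) :
    PowerSeries.coeff n (2 * f) = 2 * PowerSeries.coeff n f := by
  rw [two_mul, map_add, two_mul]

theorem S_one_one_eq : S 1 1 = oddSeries fun n => (catalan (2 * n + 1) : ℚ) := by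
  ext n
  have h := congrArg (PowerSeries.coeff n) two_mul_S_one_one
  rw [coeff_two_mul, map_sub, PowerSeries.coeff_rescale, coeff_catalanGF] at h
  rw [oddSeries, PowerSeries.coeff_mk]
  split_ifs with hn
  · rw [hn.neg_one_pow] at h
    rw [show 2 * (n / 2) + 1 = n by obtain ⟨k, rfl⟩ := hn; omega]
    linarith
  · rw [(Nat.not_odd_iff_even.1 hn).neg_one_pow] at h
    linarith

theorem S_zero_two_eq :
    S 0 2 = evenSeries fun n => if 1 ≤ n then (catalan (2 * n) : ℚ) else 0 := by
  ext n
  have h := congrArg (PowerSeries.coeff n) two_mul_S_zero_two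
  rw [coeff_two_mul, map_sub, map_add, PowerSeries.coeff_rescale, coeff_catalanGF,
    show (2 : ℚ⟦X⟧) = PowerSeries.C 2 from (map_ofNat _ 2).symm, PowerSeries.coeff_C] at h
  rw [evenSeries, PowerSeries.coeff_mk]
  by_cases hn : Even n
  · rw [hn.neg_one_pow] at h
    obtain ⟨k, rfl⟩ := hn
    rw [if_pos ⟨k, rfl⟩, show (k + k) / 2 = k by omega, two_mul]
    rcases Nat.eq_zero_or_pos k with rfl | hk
    · simp at h ⊢
      linarith
    · rw [if_neg (by omega)] at h
      rw [if_pos (Nat.succ_le_of_lt hk)]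
      linarith
  · rw [(Nat.not_even_iff_odd.1 hn).neg_one_pow, if_neg (by rintro rfl; simp at hn)] at h
    rw [if_neg hn]
    linarith

theorem S_neg_one_one_eq : S (-1) 1 =
    oddSeries fun n => 2 * 4 ^ n * (catalan n : ℚ) - (catalan (2 * n + 1) : ℚ) := by
  have h : S (-1) 1 = cSeries - S 1 1 := by rw [← S_neg_one_add_S_one]; ring
  rw [h, S_one_one_eq]
  ext n
  rw [map_sub, cSeries, mul_assoc, coeff_two_mul, ← evenSeries_catalan_four]
  cases n with
  | zero => simp [oddSeries]
  | succ n =>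
    rw [PowerSeries.coeff_succ_X_mul]
    simp only [oddSeries, evenSeries, PowerSeries.coeff_mk, Nat.odd_add_one, Nat.not_odd_iff_even]
    split_ifs with h
    · rw [show (n + 1) / 2 = n / 2 by obtain ⟨k, rfl⟩ := h; omega]
      ring
    · ring

theorem choose_neg_half (k : ℕ) :
    Ring.choose (-(1 / 2) : ℚ) k * (-4) ^ k = Nat.centralBinom k := by
  induction k with
  | zero => simp
  | succ k ih =>
    have h1 := succ_mul_choose (-(1 / 2)) k
    have h2 : ((k : ℚ) + 1) * Nat.centralBinom (k + 1) = 2 * (2 * k + 1) * Nat.centralBinom k := by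
      exact_mod_cast Nat.succ_mul_centralBinom_succ k
    have h3 : (k : ℚ) + 1 ≠ 0 := by positivity
    apply mul_left_cancel₀ h3
    rw [h2, ← ih, pow_succ]
    linear_combination (-4) ^ k * (-4) * h1

theorem S_two_mul_zero_eq (i : ℕ) : S (2 * i) 0 = PowerSeries.C ((2 * i).choose i : ℚ) *
    PowerSeries.X ^ (2 * i) * PowerSeries.rescale 2 catalanSqGF ^ (2 * i) := by
  have h1 : -cSeries ^ 2 = PowerSeries.C (-4) *
      (PowerSeries.X * PowerSeries.rescale 2 catalanSqGF) ^ 2 := by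
    rw [cSeries, map_neg, show (PowerSeries.C (4 : ℚ) : ℚ⟦X⟧) = 4 from map_ofNat _ 4]
    ring
  rw [S_two_mul_zero, h1, mul_pow, ← map_pow, ← mul_assoc, ← map_mul, choose_neg_half,
    Nat.centralBinom_eq_two_mul_choose, ← pow_mul, mul_pow, mul_assoc]

/-- The ballot numbers, by a double induction on Cᵏ⁺¹ = Cᵏ + xCᵏ⁺². Keeping the factor 2m + k on the
left covers m = k = 0. -/
theorem coeff_catalanGF_pow (m k : ℕ) :
    (2 * m + k : ℚ) * PowerSeries.coeff m (catalanGF ^ k) = k * (2 * m + k).choose m := by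
  induction m generalizing k with
  | zero =>
    have h : PowerSeries.constantCoeff catalanGF = 1 := by
      rw [← PowerSeries.coeff_zero_eq_constantCoeff_apply, coeff_catalanGF, catalan_zero,
        Nat.cast_one]
    simp [h]
  | succ m ih =>
    induction k with
    | zero => simp [PowerSeries.coeff_one]
    | succ k ihk =>
      have h : catalanGF ^ (k + 1) = catalanGF ^ k + PowerSeries.X * catalanGF ^ (k + 2) := by
        linear_combination catalanGF ^ k * catalanGF_eq
      have h2 := ih (k + 2)
      rw [h, map_add, PowerSeries.coeff_succ_X_mul]
      rw [show 2 * (m + 1) + (k + 1) = (2 * m + (k + 2)) + 1 by ring, Nat.choose_succ_succ]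
      rw [show 2 * (m + 1) + k = 2 * m + (k + 2) by ring] at ihk
      have h3 : ((2 * m + (k + 2)).choose (m + 1) : ℚ) * (m + 1) =
          (2 * m + (k + 2)).choose m * (m + k + 2) := by
        have := Nat.choose_succ_right_eq (2 * m + (k + 2)) m
        rw [show 2 * m + (k + 2) - m = m + k + 2 by omega] at this
        exact_mod_cast this
      have h0 : (2 * m + k + 2 : ℚ) ≠ 0 := by positivity
      apply mul_left_cancel₀ h0
      push_cast at *
      linear_combination (2 * m + k + 3 : ℚ) * (ihk + h2) - 2 * h3

theorem S_two_mul_zero_eq_evenSeries (i : ℕ) (hi : 1 ≤ i) :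
    S (2 * i) 0 = evenSeries fun n => if i ≤ n then
      (i : ℚ) / n * ((2 * i).choose i : ℚ) * ((2 * n).choose (n - i) : ℚ) * 4 ^ (n - i) else 0 := by
  rw [S_two_mul_zero_eq]
  ext m
  rw [mul_assoc, PowerSeries.coeff_C_mul, PowerSeries.coeff_X_pow_mul', ← map_pow,
    PowerSeries.coeff_rescale, catalanSqGF, ← map_pow, PowerSeries.coeff_expand, evenSeries,
    PowerSeries.coeff_mk]
  by_cases hm : Even m
  · obtain ⟨n, rfl⟩ := hm
    rw [← two_mul, if_pos (even_two_mul n), Nat.mul_div_cancel_left n two_pos]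
    by_cases h : i ≤ n
    · obtain ⟨l, rfl⟩ := Nat.exists_eq_add_of_le h
      rw [if_pos (by omega), if_pos h, show 2 * (i + l) - 2 * i = 2 * l by omega,
        if_pos (dvd_mul_right 2 l), Nat.mul_div_cancel_left l two_pos, Nat.add_sub_cancel_left]
      have h1 := coeff_catalanGF_pow l (2 * i)
      rw [show 2 * l + 2 * i = 2 * (i + l) by ring] at h1
      have h0 : ((i + l : ℕ) : ℚ) ≠ 0 := by
        have : 0 < i + l := by omega
        positivity
      have h2 : PowerSeries.coeff l (catalanGF ^ (2 * i)) =
          (i : ℚ) / (i + l : ℕ) * (2 * (i + l)).choose l := by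
        rw [div_mul_eq_mul_div, eq_div_iff h0]
        push_cast at h1 ⊢
        linear_combination h1 / 2
      rw [h2, pow_mul]
      norm_num
      ring
    · rw [if_neg (by omega), if_neg h, mul_zero]
  · rw [if_neg hm]
    split_ifs with h1 h2
    · exfalso
      apply hm
      rw [even_iff_two_dvd]
      omega
    all_goals simp

/-! ### Irrationality over `ℚ(t)` -/

open Filter Topology

theorem hasSum_coeff_mul {f : ℚ⟦X⟧} {x A : ℝ}
    (h : HasSum (fun n => ((PowerSeries.coeff n f : ℚ) : ℝ) * x ^ n) A) (Q : Polynomial ℚ) :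
    HasSum (fun n => ((PowerSeries.coeff n ((Q : ℚ⟦X⟧) * f) : ℚ) : ℝ) * x ^ n)
      (Polynomial.aeval x Q * A) := by
  have key (n : ℕ) (r : ℚ) : HasSum (fun m => ((PowerSeries.coeff m
      (((Polynomial.C r * Polynomial.X ^ n : Polynomial ℚ) : ℚ⟦X⟧) * f) : ℚ) : ℝ) * x ^ m)
      (Polynomial.aeval x (Polynomial.C r * Polynomial.X ^ n) * A) := by
    induction n with
    | zero =>
      simp only [pow_zero, mul_one, Polynomial.coe_C, PowerSeries.coeff_C_mul, Rat.cast_mul,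
        Polynomial.aeval_C, mul_assoc, eq_ratCast]
      exact h.mul_left _
    | succ n ih =>
      rw [← hasSum_nat_add_iff' 1]
      have e : ((Polynomial.C r * Polynomial.X ^ (n + 1) : Polynomial ℚ) : ℚ⟦X⟧) * f =
          PowerSeries.X * (((Polynomial.C r * Polynomial.X ^ n : Polynomial ℚ) : ℚ⟦X⟧) * f) := by
        push_cast
        ring
      simp only [e, PowerSeries.coeff_succ_X_mul, Finset.sum_range_one, PowerSeries.coeff_zero_X_mul,
        Rat.cast_zero, zero_mul, sub_zero]
      have e' : Polynomial.aeval x (Polynomial.C r * Polynomial.X ^ (n + 1)) * A =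
          x * (Polynomial.aeval x (Polynomial.C r * Polynomial.X ^ n) * A) := by
        simp only [map_mul, map_pow, Polynomial.aeval_X]
        ring
      rw [e']
      refine Eq.subst (motive := fun F => HasSum F _) (funext fun m => ?_) (ih.mul_left x)
      ring
  induction Q using Polynomial.induction_on' with
  | add p q hp hq =>
    simp only [Polynomial.coe_add, add_mul, map_add, Rat.cast_add]
    exact hp.add hq
  | monomial n r =>
    rw [← Polynomial.C_mul_X_pow_eq_monomial]
    exact key n r

theorem hasSum_coeff_polynomial (P : Polynomial ℚ) (x : ℝ) :
    HasSum (fun n => ((PowerSeries.coeff n (P : ℚ⟦X⟧) : ℚ) : ℝ) * x ^ n) (Polynomial.aeval x P) := by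
  have h : HasSum (fun n => ((PowerSeries.coeff n (1 : ℚ⟦X⟧) : ℚ) : ℝ) * x ^ n) 1 := by
    convert hasSum_ite_eq (0 : ℕ) (1 : ℝ) using 2 with n
    rw [PowerSeries.coeff_one]
    split_ifs with h <;> simp [h]
  simpa using hasSum_coeff_mul h P

theorem exists_coprime_representation {f : ℚ⟦X⟧} {P Q : Polynomial ℚ} (hQ : Q ≠ 0)
    (h : (Q : ℚ⟦X⟧) * f = P) :
    ∃ P' Q' : Polynomial ℚ, IsCoprime P' Q' ∧ (Q' : ℚ⟦X⟧) * f = P' := by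
  obtain ⟨P', hP'⟩ := EuclideanDomain.gcd_dvd_left P Q
  obtain ⟨Q', hQ'⟩ := EuclideanDomain.gcd_dvd_right P Q
  have hg : EuclideanDomain.gcd P Q ≠ 0 := fun h0 => hQ (EuclideanDomain.gcd_eq_zero_iff.1 h0).2
  refine ⟨P', Q', ?_, ?_⟩
  · have := EuclideanDomain.gcd_eq_gcd_ab P Q
    refine ⟨EuclideanDomain.gcdA P Q, EuclideanDomain.gcdB P Q, ?_⟩
    apply mul_left_cancel₀ hg
    rw [mul_one, mul_add]
    conv_rhs => rw [this]
    linear_combination -(EuclideanDomain.gcdA P Q) * hP' - (EuclideanDomain.gcdB P Q) * hQ'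
  · have hg' : ((EuclideanDomain.gcd P Q : Polynomial ℚ) : ℚ⟦X⟧) ≠ 0 := by
      rwa [Ne, Polynomial.coe_eq_zero_iff]
    apply mul_left_cancel₀ hg'
    rw [← mul_assoc, ← Polynomial.coe_mul, ← Polynomial.coe_mul, ← hP', ← hQ', h]

/-- A rational function that is the sum of a convergent series at r has no pole there, so it is
differentiable at r. By nonnegativity of the coefficients, its derivative bounds the termwise
derivative of every partial sum. -/
theorem summable_mul_of_rational {f : ℚ⟦X⟧} {P Q : Polynomial ℚ} (hQ : Q ≠ 0)
    (h : (Q : ℚ⟦X⟧) * f = P) (hf : ∀ n, 0 ≤ PowerSeries.coeff n f) {r : ℝ} (hr : 0 < r)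
    (hs : Summable fun n => ((PowerSeries.coeff n f : ℚ) : ℝ) * r ^ n) :
    Summable fun n : ℕ => (n : ℝ) * (((PowerSeries.coeff n f : ℚ) : ℝ) * r ^ n) := by
  obtain ⟨P, Q, hPQ, h⟩ := exists_coprime_representation hQ h
  have hf' (n : ℕ) : (0 : ℝ) ≤ (PowerSeries.coeff n f : ℚ) := by exact_mod_cast hf n
  have hsum {x : ℝ} (hx : 0 ≤ x) (hxr : x ≤ r) :
      Summable fun n => ((PowerSeries.coeff n f : ℚ) : ℝ) * x ^ n := by
    refine Summable.of_nonneg_of_le (fun n => mul_nonneg (hf' n) (by positivity)) (fun n => ?_) hs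
    exact mul_le_mul_of_nonneg_left (pow_le_pow_left₀ hx hxr n) (hf' n)
  set F : ℝ → ℝ := fun x => ∑' n, ((PowerSeries.coeff n f : ℚ) : ℝ) * x ^ n with hF
  have hrel {x : ℝ} (hx : 0 ≤ x) (hxr : x ≤ r) :
      Polynomial.aeval x Q * F x = Polynomial.aeval x P := by
    have h1 := hasSum_coeff_mul (hsum hx hxr).hasSum Q
    rw [h] at h1
    exact h1.unique (hasSum_coeff_polynomial P x)
  -- Convergence at r itself gives Q(r)F(r) = P(r), so a zero of Q at r would be one of P, against
  -- coprimality.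
  have hQr : Polynomial.aeval r Q ≠ 0 := by
    intro h0
    have h1 := hrel hr.le le_rfl
    rw [h0, zero_mul] at h1
    obtain ⟨A, B, hAB⟩ := hPQ
    have := congrArg (Polynomial.aeval r) hAB
    rw [map_add, map_mul, map_mul, h0, ← h1, map_one] at this
    simp at this
  set g : ℝ → ℝ := fun x => Polynomial.aeval x P / Polynomial.aeval x Q with hg
  have hgd : HasDerivAt g (deriv g r) r := by
    apply DifferentiableAt.hasDerivAt
    exact (P.differentiable_aeval r).div (Q.differentiable_aeval r) hQr
  have hgF : ∀ᶠ x in 𝓝 r, 0 ≤ x → x ≤ r → g x = F x := by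
    have : ∀ᶠ x in 𝓝 r, Polynomial.aeval x Q ≠ 0 :=
      (Q.continuous_aeval.continuousAt).eventually_ne hQr
    filter_upwards [this] with x hx h0 hxr
    rw [hg]
    simp only
    rw [← hrel h0 hxr, mul_div_cancel_left₀ _ hx]
  have hbound (N : ℕ) : ∑ n ∈ Finset.range N, (n : ℝ) * (((PowerSeries.coeff n f : ℚ) : ℝ) * r ^ n) ≤
      r * deriv g r := by
    set p : ℝ → ℝ := fun x => ∑ n ∈ Finset.range N, ((PowerSeries.coeff n f : ℚ) : ℝ) * x ^ n with hp
    have hpd : HasDerivAt p (∑ n ∈ Finset.range N, ((PowerSeries.coeff n f : ℚ) : ℝ) *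
        (n * r ^ (n - 1))) r := by
      rw [hp]
      exact HasDerivAt.fun_sum fun n _ => (hasDerivAt_pow n r).const_mul _
    have hd := hgd.sub hpd
    rw [hasDerivAt_iff_tendsto_slope] at hd
    have hd' := hd.mono_left (nhdsWithin_mono r (show Set.Iio r ⊆ {r}ᶜ from fun x hx => ne_of_lt hx))
    -- To the left of r, g minus the partial sum is the tail of the series, which is nondecreasing;
    -- its slopes, hence its derivative at r, are nonnegative.
    have hnn : 0 ≤ deriv g r - ∑ n ∈ Finset.range N, ((PowerSeries.coeff n f : ℚ) : ℝ) *
        (n * r ^ (n - 1)) := by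
      refine ge_of_tendsto hd' ?_
      have hpos : ∀ᶠ x in 𝓝 r, 0 < x := lt_mem_nhds hr
      filter_upwards [self_mem_nhdsWithin, nhdsWithin_le_nhds hgF, nhdsWithin_le_nhds hpos] with x hx
        hx1 hx0
      have hxr : x ≤ r := le_of_lt hx
      have hgr : g r = F r := hgF.self_of_nhds hr.le le_rfl
      rw [slope_def_field]
      refine div_nonneg_of_nonpos ?_ (by linarith)
      simp only [Pi.sub_apply]
      rw [hx1 hx0.le hxr, hgr, hF, hp]
      simp only
      have h1 := (hsum hx0.le hxr).sum_add_tsum_nat_add N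
      have h2 := (hsum hr.le le_rfl).sum_add_tsum_nat_add N
      rw [← h1, ← h2, add_sub_cancel_left, add_sub_cancel_left, sub_nonpos]
      refine Summable.tsum_le_tsum (fun n => ?_) ((summable_nat_add_iff N).2 (hsum hx0.le hxr))
        ((summable_nat_add_iff N).2 (hsum hr.le le_rfl))
      exact mul_le_mul_of_nonneg_left (pow_le_pow_left₀ hx0.le hxr _) (hf' _)
    have h3 := mul_le_mul_of_nonneg_left (sub_nonneg.1 hnn) hr.le
    refine le_trans (le_of_eq ?_) h3
    rw [Finset.mul_sum]
    refine Finset.sum_congr rfl fun n _ => ?_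
    cases n with
    | zero => simp
    | succ n => rw [Nat.add_sub_cancel, pow_succ]; ring
  exact summable_of_sum_range_le (fun n => mul_nonneg (by positivity)
    (mul_nonneg (hf' n) (by positivity))) hbound

theorem sum_catalan_div (n : ℕ) : ∑ k ∈ Finset.range n, (catalan k : ℝ) * (1 / 4) ^ k =
    2 - 2 * (Nat.centralBinom n * (1 / 4) ^ n) := by
  induction n with
  | zero => simp
  | succ n ih =>
    have h1 : ((n : ℝ) + 1) * catalan n = Nat.centralBinom n := by
      exact_mod_cast succ_mul_catalan_eq_centralBinom n
    have h2 : ((n : ℝ) + 1) * Nat.centralBinom (n + 1) = 2 * (2 * n + 1) * Nat.centralBinom n := by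
      exact_mod_cast Nat.succ_mul_centralBinom_succ n
    have h3 : (n : ℝ) + 1 ≠ 0 := by positivity
    apply mul_left_cancel₀ h3
    rw [Finset.sum_range_succ, ih, pow_succ]
    linear_combination (1 / 4 : ℝ) ^ n * h1 + (1 / 2) * (1 / 4) ^ n * h2

theorem summable_catalan : Summable fun n => (catalan n : ℝ) * (1 / 4) ^ n := by
  refine summable_of_sum_range_le (c := 2) (fun n => by positivity) fun n => ?_
  rw [sum_catalan_div]
  have : (0 : ℝ) ≤ Nat.centralBinom n * (1 / 4) ^ n := by positivity
  linarith

theorem coeff_S (i j : ℤ) (n : ℕ) : PowerSeries.coeff n (S i j) = a i j n := by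
  rw [S, PowerSeries.coeff_mk]

theorem a_one_one (n : ℕ) : a 1 1 n = if Odd n then catalan n else 0 := by
  have h := congrArg (PowerSeries.coeff n) S_one_one_eq
  rw [coeff_S, oddSeries, PowerSeries.coeff_mk] at h
  have h' : (if Odd n then (catalan (2 * (n / 2) + 1) : ℚ) else 0) =
      ((if Odd n then catalan n else 0 : ℕ) : ℚ) := by
    split_ifs with hn
    · rw [show 2 * (n / 2) + 1 = n by obtain ⟨k, rfl⟩ := hn; omega]
    · simp
  rw [h'] at h
  exact_mod_cast h

theorem summable_a_one_one : Summable fun n => (a 1 1 n : ℝ) * (1 / 4) ^ n := by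
  refine Summable.of_nonneg_of_le (fun n => by positivity) (fun n => ?_) summable_catalan
  rw [a_one_one]
  refine mul_le_mul_of_nonneg_right ?_ (by positivity)
  split_ifs <;> simp

/-- From 4ⁿ ≤ 2n binom(2n, n) and binom(2n, n) = (n + 1)Cₙ, the term nCₙ/4ⁿ is at least 1/(2(n +
1)). Along odd n this dominates a multiple of the harmonic series. -/
theorem not_summable_mul_a_one_one :
    ¬Summable fun n : ℕ => (n : ℝ) * ((a 1 1 n : ℝ) * (1 / 4) ^ n) := by
  intro h
  have h1 := h.comp_injective (i := fun n : ℕ => 2 * n + 1) fun m n h => by simpa using h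
  have h2 : Summable fun n : ℕ => (1 : ℝ) / ((n + 1 : ℕ) : ℝ) := by
    refine Summable.of_nonneg_of_le (fun n => by positivity) (fun n => ?_) (h1.mul_left 4)
    simp only [Function.comp_apply, a_one_one, if_pos (odd_two_mul_add_one n)]
    have h3 : (4 : ℝ) ^ (2 * n + 1) ≤ 2 * (2 * n + 1 : ℕ) * Nat.centralBinom (2 * n + 1) := by
      exact_mod_cast Nat.four_pow_le_two_mul_self_mul_centralBinom (2 * n + 1) (by omega)
    have h4 : (((2 * n + 1 : ℕ) : ℝ) + 1) * catalan (2 * n + 1) = Nat.centralBinom (2 * n + 1) := by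
      exact_mod_cast succ_mul_catalan_eq_centralBinom (2 * n + 1)
    rw [← h4] at h3
    push_cast at h3 ⊢
    rw [div_le_iff₀ (by positivity), one_div, inv_pow]
    have h5 : (0 : ℝ) < 4 ^ (2 * n + 1) := by positivity
    have h6 : 4 * ((2 * n + 1 : ℝ) * (catalan (2 * n + 1) * (4 ^ (2 * n + 1))⁻¹)) * (n + 1) =
        (2 * (2 * n + 1) * ((2 * n + 1 + 1) * catalan (2 * n + 1))) / 4 ^ (2 * n + 1) := by
      field_simp
      ring
    rw [h6, le_div_iff₀ h5, one_mul]
    exact h3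
  exact Real.not_summable_one_div_natCast ((summable_nat_add_iff 1).1 h2)

/-- One half of the comparison with (1, 1) gives convergence at 1/4 for (i, j). Were the series
rational, ∑ n a(n)/4ⁿ would converge too, and the other half would carry this back to (1, 1). A
shift of the length by m only costs a factor 4ᵐ. -/
theorem not_rational_S (i j : ℤ) (h : Even (i + j)) (hm : (i, j) ∉ halfLine) {P Q : Polynomial ℚ}
    (hQ : Q ≠ 0) : (Q : ℚ⟦X⟧) * S i j ≠ P := by
  intro hPQ
  obtain ⟨⟨m, h1⟩, m', h2⟩ := comparable_one_one i j h hm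
  simp only at h1 h2
  have hs : Summable fun n => (a i j n : ℝ) * (1 / 4) ^ n := by
    refine Summable.of_nonneg_of_le (fun n => by positivity) (fun n => ?_)
      (((summable_nat_add_iff m).2 summable_a_one_one).mul_left (4 ^ m))
    have : (4 : ℝ) ^ m * (a 1 1 (n + m) * (1 / 4) ^ (n + m)) = a 1 1 (n + m) * (1 / 4) ^ n := by
      rw [pow_add, one_div, inv_pow, inv_pow]
      field_simp
    rw [this]
    exact mul_le_mul_of_nonneg_right (by exact_mod_cast h1 n) (by positivity)
  have hs' := summable_mul_of_rational (r := 1 / 4) hQ hPQ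
    (fun n => by rw [coeff_S]; positivity) (by norm_num) (by simpa only [coeff_S, Rat.cast_natCast])
  simp only [coeff_S, Rat.cast_natCast] at hs'
  apply not_summable_mul_a_one_one
  refine Summable.of_nonneg_of_le (fun n => by positivity) (fun n => ?_)
    (((summable_nat_add_iff m').2 hs').mul_left (4 ^ m'))
  have : (4 : ℝ) ^ m' * (((n + m' : ℕ) : ℝ) * (a i j (n + m') * (1 / 4) ^ (n + m'))) =
      ((n + m' : ℕ) : ℝ) * (a i j (n + m') * (1 / 4) ^ n) := by
    rw [pow_add, one_div, inv_pow, inv_pow]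
    field_simp
  rw [this]
  have h3 : (a 1 1 n : ℝ) ≤ a i j (n + m') := by exact_mod_cast h2 n
  have h4 : (n : ℝ) ≤ (n + m' : ℕ) := by exact_mod_cast Nat.le_add_right n m'
  gcongr

theorem S_not_mem_adjoin_t (i j : ℤ) (h : Even (i + j)) (hm : (i, j) ∉ halfLine) :
    (S i j : ℚ⸨X⸩) ∉ IntermediateField.adjoin ℚ {t} := by
  intro hS
  obtain ⟨P, Q, hPQ⟩ := (IntermediateField.mem_adjoin_simple_iff ℚ _).1 hS
  have hcoe (R : Polynomial ℚ) : Polynomial.aeval t R = ((R : ℚ⟦X⟧) : ℚ⸨X⸩) := by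
    induction R using Polynomial.induction_on' with
    | add p q hp hq => rw [map_add, hp, hq, Polynomial.coe_add, map_add]
    | monomial n r =>
      rw [Polynomial.aeval_monomial, Polynomial.coe_monomial, PowerSeries.monomial_eq_C_mul_X_pow,
        map_mul, map_pow, t]
      congr 1
  rw [hcoe, hcoe] at hPQ
  by_cases hQ : Q = 0
  · rw [hQ, Polynomial.coe_zero, map_zero, div_zero, map_eq_zero_iff _
      HahnSeries.ofPowerSeries_injective] at hPQ
    exact not_rational_S i j h hm (P := 0) (Q := 1) one_ne_zero (by simp [hPQ])
  · have h0 : ((Q : ℚ⟦X⟧) : ℚ⸨X⸩) ≠ 0 := by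
      rwa [Ne, map_eq_zero_iff _ HahnSeries.ofPowerSeries_injective, Polynomial.coe_eq_zero_iff]
    rw [eq_div_iff h0, ← map_mul] at hPQ
    apply not_rational_S i j h hm hQ (P := P)
    rw [mul_comm]
    exact HahnSeries.ofPowerSeries_injective hPQ

/-! ### Field generators and degrees over `ℚ(t)` -/

theorem rPlus_sq : rPlus ^ 2 = 1 + 4 * t := by
  have h := congrArg (HahnSeries.ofPowerSeries ℤ ℚ) (sqrtSeries_sq 4)
  rw [show (PowerSeries.C (4 : ℚ) : ℚ⟦X⟧) = 4 from map_ofNat _ 4] at h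
  simp only [map_pow, map_add, map_mul, map_one, map_ofNat] at h
  exact h

theorem rMinus_sq : rMinus ^ 2 = 1 - 4 * t := by
  have h := congrArg (HahnSeries.ofPowerSeries ℤ ℚ) (sqrtSeries_sq (-4))
  rw [map_neg, show (PowerSeries.C (4 : ℚ) : ℚ⟦X⟧) = 4 from map_ofNat _ 4] at h
  simp only [map_pow, map_add, map_mul, map_neg, map_one, map_ofNat] at h
  rw [sub_eq_add_neg, ← neg_mul]
  exact h

theorem coe_ne_zero {f : ℚ⟦X⟧} (h : f ≠ 0) : (f : ℚ⸨X⸩) ≠ 0 :=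
  (map_ne_zero_iff (HahnSeries.ofPowerSeries ℤ ℚ) HahnSeries.ofPowerSeries_injective).2 h

theorem t_ne_zero : t ≠ 0 := coe_ne_zero PowerSeries.X_ne_zero

theorem one_sub_u_sq_ne_zero : 1 - u ^ 2 ≠ 0 := by
  have h := coe_ne_zero one_sub_uSeries_sq_ne_zero
  rwa [map_sub, map_pow, map_one, ← u_eq] at h

theorem one_add_u_sq_ne_zero : 1 + u ^ 2 ≠ 0 := by
  have h := coe_ne_zero one_add_uSeries_sq_ne_zero
  rwa [map_add, map_pow, map_one, ← u_eq] at h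

theorem rMinus_eq : rMinus = (1 - 2 * u - u ^ 2) / (1 + u ^ 2) := by
  have h := congrArg (HahnSeries.ofPowerSeries ℤ ℚ) sqrtSeries_neg_four_mul
  simp only [map_pow, map_add, map_sub, map_mul, map_one, map_ofNat] at h
  rw [eq_div_iff one_add_u_sq_ne_zero, u_eq]
  exact h

theorem rPlus_eq : rPlus = (1 + 2 * u - u ^ 2) / (1 + u ^ 2) := by
  have h := congrArg (HahnSeries.ofPowerSeries ℤ ℚ) sqrtSeries_four_mul
  simp only [map_pow, map_add, map_sub, map_mul, map_one, map_ofNat] at h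
  rw [eq_div_iff one_add_u_sq_ne_zero, u_eq]
  exact h

theorem four_ne_zero_laurent : (4 : ℚ⸨X⸩) ≠ 0 := by
  have h := coe_ne_zero four_powerSeries_ne_zero
  rwa [map_ofNat] at h

theorem t_eq : t = (rPlus ^ 2 - 1) / 4 := by
  rw [rPlus_sq, add_sub_cancel_left, mul_div_cancel_left₀ _ four_ne_zero_laurent]

theorem adjoin_u_eq : IntermediateField.adjoin ℚ {u} =
    IntermediateField.adjoin ℚ {t, rMinus, rPlus} := by
  apply le_antisymm
  · rw [IntermediateField.adjoin_le_iff, Set.singleton_subset_iff]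
    have h1 : rMinus ∈ IntermediateField.adjoin ℚ {t, rMinus, rPlus} :=
      IntermediateField.subset_adjoin _ _ (by simp)
    have h2 : rPlus ∈ IntermediateField.adjoin ℚ {t, rMinus, rPlus} :=
      IntermediateField.subset_adjoin _ _ (by simp)
    exact div_mem (sub_mem h2 (one_mem _)) (add_mem h1 (one_mem _))
  · have hu : u ∈ IntermediateField.adjoin ℚ {u} :=
      IntermediateField.mem_adjoin_simple_self ℚ u
    have h2 : (2 : ℚ⸨X⸩) ∈ IntermediateField.adjoin ℚ {u} := ofNat_mem _ 2
    have h4 : (4 : ℚ⸨X⸩) ∈ IntermediateField.adjoin ℚ {u} := ofNat_mem _ 4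
    have hp : rPlus ∈ IntermediateField.adjoin ℚ {u} := by
      rw [rPlus_eq]
      exact div_mem (sub_mem (add_mem (one_mem _) (mul_mem h2 hu)) (pow_mem hu 2))
        (add_mem (one_mem _) (pow_mem hu 2))
    have hm : rMinus ∈ IntermediateField.adjoin ℚ {u} := by
      rw [rMinus_eq]
      exact div_mem (sub_mem (sub_mem (one_mem _) (mul_mem h2 hu)) (pow_mem hu 2))
        (add_mem (one_mem _) (pow_mem hu 2))
    rw [IntermediateField.adjoin_le_iff]
    rintro y (rfl | rfl | rfl)
    · rw [t_eq]
      exact div_mem (sub_mem (pow_mem hp 2) (one_mem _)) h4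
    · exact hm
    · exact hp

theorem S_eq_div (i j : ℤ) : (S i j : ℚ⸨X⸩) =
    polyEval (numerator (i, j)) u / polyEval (denominator (i, j)) u := by
  rw [polyEval_numerator, polyEval_denominator, mul_div_cancel_left₀ _ (u_sub_pow_ne_zero _)]

theorem polyEval_mem {A : Type*} [SetLike A ℚ⸨X⸩] [SubringClass A ℚ⸨X⸩] {F : A} {x : ℚ⸨X⸩} (hx : x ∈ F) (l : List ℤ) :
    polyEval l x ∈ F := by
  induction l with
  | nil => exact zero_mem F
  | cons c l ih =>
    rw [polyEval_cons]
    exact add_mem (intCast_mem _ c) (mul_mem hx ih)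

theorem S_mem_adjoin_u (i j : ℤ) : (S i j : ℚ⸨X⸩) ∈ IntermediateField.adjoin ℚ {u} := by
  have hu := IntermediateField.mem_adjoin_simple_self ℚ u
  rw [S_eq_div]
  exact div_mem (polyEval_mem hu _) (polyEval_mem hu _)

theorem finrank_adjoin_dvd_two {F E : Type*} [Field F] [Field E] [Algebra F E] (x : E) (d : F)
    (h : x ^ 2 = algebraMap F E d) :
    IsIntegral F x ∧ Module.finrank F (IntermediateField.adjoin F {x}) ∣ 2 := by
  have hm : (Polynomial.X ^ 2 - Polynomial.C d).Monic := Polynomial.monic_X_pow_sub_C d two_ne_zero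
  have h0 : Polynomial.aeval x (Polynomial.X ^ 2 - Polynomial.C d) = 0 := by simp [h]
  have hi : IsIntegral F x := ⟨_, hm, h0⟩
  refine ⟨hi, ?_⟩
  rw [IntermediateField.adjoin.finrank hi]
  have h1 : (minpoly F x).natDegree ≤ 2 :=
    (Polynomial.natDegree_le_natDegree (minpoly.min F x hm h0)).trans
      (Polynomial.natDegree_X_pow_sub_C).le
  have h2 := minpoly.natDegree_pos hi
  interval_cases (minpoly F x).natDegree <;> norm_num

/-- F ⊆ F(x) ⊆ F(x, y) is a tower whose two steps have degree 1 or 2, and the degree of an element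
divides that of the extension. -/
theorem minpoly_natDegree_dvd_four {F L : Type*} [Field F] [Field L] [Algebra F L] {x y : L}
    {d e : F} (hx : x ^ 2 = algebraMap F L d) (hy : y ^ 2 = algebraMap F L e) {z : L}
    (hz : z ∈ Subfield.closure {x, y}) : (minpoly F z).natDegree ∣ 4 := by
  obtain ⟨i1, d1⟩ := finrank_adjoin_dvd_two x d hx
  obtain ⟨i2, d2⟩ := finrank_adjoin_dvd_two (F := IntermediateField.adjoin F {x}) y
    (algebraMap F _ e) (by rw [hy, ← IsScalarTower.algebraMap_apply])
  have f1 := IntermediateField.adjoin.finiteDimensional i1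
  have f2 := IntermediateField.adjoin.finiteDimensional i2
  set E := IntermediateField.adjoin F {x}
  set G := IntermediateField.adjoin E {y}
  have f3 : FiniteDimensional F G := FiniteDimensional.trans F E G
  have f4 : Module.Free E G := Module.Free.of_divisionRing E G
  have f5 : IsScalarTower F G L := IsScalarTower.of_algebraMap_eq fun _ => rfl
  have hd : Module.finrank F G ∣ 4 := by
    rw [← Module.finrank_mul_finrank F E G]
    exact mul_dvd_mul d1 d2
  have hzG : z ∈ G := by
    have h : Subfield.closure {x, y} ≤ G.toSubfield := by
      rw [Subfield.closure_le]
      rintro w (rfl | rfl)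
      · exact G.algebraMap_mem ⟨w, IntermediateField.mem_adjoin_simple_self F w⟩
      · exact IntermediateField.mem_adjoin_simple_self E w
    exact h hz
  have h2 : minpoly F (⟨z, hzG⟩ : G) = minpoly F z :=
    (minpoly.algebraMap_eq (FaithfulSMul.algebraMap_injective G L) (⟨z, hzG⟩ : G)).symm
  rw [← h2]
  exact (minpoly.degree_dvd (IsIntegral.of_finite F (⟨z, hzG⟩ : G))).trans hd

theorem S_mem_closure (i j : ℤ) : (S i j : ℚ⸨X⸩) ∈ Subfield.closure {rMinus, rPlus} := by
  have hm : rMinus ∈ Subfield.closure {rMinus, rPlus} := Subfield.subset_closure (by simp)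
  have hp : rPlus ∈ Subfield.closure {rMinus, rPlus} := Subfield.subset_closure (by simp)
  have hu : u ∈ Subfield.closure {rMinus, rPlus} :=
    div_mem (sub_mem hp (one_mem _)) (add_mem hm (one_mem _))
  rw [S_eq_div]
  exact div_mem (polyEval_mem hu _) (polyEval_mem hu _)

theorem minpoly_S_natDegree_dvd_four (i j : ℤ) :
    (minpoly (IntermediateField.adjoin ℚ {t}) (S i j : ℚ⸨X⸩)).natDegree ∣ 4 := by
  set T : IntermediateField.adjoin ℚ {t} := ⟨t, IntermediateField.mem_adjoin_simple_self ℚ t⟩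
  refine minpoly_natDegree_dvd_four (x := rMinus) (y := rPlus) (d := 1 - 4 * T) (e := 1 + 4 * T)
    ?_ ?_ (S_mem_closure i j)
  · rw [rMinus_sq, map_sub, map_mul, map_one, map_ofNat]; rfl
  · rw [rPlus_sq, map_add, map_mul, map_one, map_ofNat]; rfl

/-- Among the divisors of 4 only 1 has to be excluded, and degree 1 would put the series in ℚ(t). -/
theorem minpoly_S_natDegree (i j : ℤ) (h : Even (i + j)) (hm : (i, j) ∉ halfLine) :
    (minpoly (IntermediateField.adjoin ℚ {t}) (S i j : ℚ⸨X⸩)).natDegree = 2 ∨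
      (minpoly (IntermediateField.adjoin ℚ {t}) (S i j : ℚ⸨X⸩)).natDegree = 4 := by
  have h4 := minpoly_S_natDegree_dvd_four i j
  have h1 : (minpoly (IntermediateField.adjoin ℚ {t}) (S i j : ℚ⸨X⸩)).natDegree ≠ 1 := by
    intro h1
    obtain ⟨y, hy⟩ := minpoly.natDegree_eq_one_iff.1 h1
    exact S_not_mem_adjoin_t i j h hm (hy ▸ y.2)
  have h5 := Nat.le_of_dvd (by norm_num) h4
  interval_cases (minpoly (IntermediateField.adjoin ℚ {t}) (S i j : ℚ⸨X⸩)).natDegree <;> omega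

/-! ### Closed forms in the field of Laurent series -/

theorem four_mul_t_ne_zero : 4 * t ≠ 0 := mul_ne_zero four_ne_zero_laurent t_ne_zero

theorem S_one_one_coe : (S 1 1 : ℚ⸨X⸩) = u * (1 + u ^ 2) / (1 - u ^ 2) := by
  have h := congrArg (HahnSeries.ofPowerSeries ℤ ℚ) S_one_one_mul
  simp only [map_pow, map_add, map_sub, map_mul, map_one, ← u_eq] at h
  rw [eq_div_iff one_sub_u_sq_ne_zero]
  exact h

theorem S_one_one_coe_t : (S 1 1 : ℚ⸨X⸩) = (2 - rMinus - rPlus) / (4 * t) := by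
  have h := congrArg (HahnSeries.ofPowerSeries ℤ ℚ) four_X_mul_S_one_one
  simp only [map_sub, map_mul, map_ofNat] at h
  rw [eq_div_iff four_mul_t_ne_zero, mul_comm]
  exact h

theorem S_zero_two_coe : (S 0 2 : ℚ⸨X⸩) = 2 * u ^ 2 / (1 - u ^ 2) := by
  have h := congrArg (HahnSeries.ofPowerSeries ℤ ℚ) S_zero_two
  simp only [map_pow, map_sub, map_mul, map_one, map_ofNat, ← u_eq] at h
  rw [eq_div_iff one_sub_u_sq_ne_zero]
  exact h

theorem S_zero_two_coe_t : (S 0 2 : ℚ⸨X⸩) = (rPlus - rMinus - 4 * t) / (4 * t) := by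
  have h := congrArg (HahnSeries.ofPowerSeries ℤ ℚ) four_X_mul_S_zero_two
  simp only [map_sub, map_mul, map_ofNat] at h
  rw [eq_div_iff four_mul_t_ne_zero, mul_comm]
  exact h

theorem S_two_mul_zero_coe (i : ℕ) : (S (2 * (i : ℤ)) 0 : ℚ⸨X⸩) =
    ((2 * i).choose i : ℚ⸨X⸩) * t ^ (2 * i) * catalanAtFourTSq ^ (2 * i) := by
  rw [S_two_mul_zero_eq, catalanAtFourTSq, evenSeries_catalan_four]
  simp only [map_mul, map_pow, t, map_natCast]

end SlitPlane

end

theorem mainTheorem9 :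
    -- every `S_{i,j}` belongs to `ℚ(u) = ℚ(t, √(1 - 4t), √(1 + 4t))`
    IntermediateField.adjoin ℚ {SlitPlane.u} =
      IntermediateField.adjoin ℚ {SlitPlane.t, SlitPlane.rMinus, SlitPlane.rPlus} ∧
    (∀ i j : ℤ, (SlitPlane.S i j : ℚ⸨X⸩) ∈ IntermediateField.adjoin ℚ {SlitPlane.u}) ∧
    -- an algorithm computes, from `(i, j)`, an expression of `S_{i,j}` as a quotient of two
    -- polynomials in `u`
    (∃ num den : ℤ × ℤ → List ℤ, Computable num ∧ Computable den ∧ ∀ i j : ℤ,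
      SlitPlane.polyEval (den (i, j)) SlitPlane.u ≠ 0 ∧
      (SlitPlane.S i j : ℚ⸨X⸩) =
        SlitPlane.polyEval (num (i, j)) SlitPlane.u /
          SlitPlane.polyEval (den (i, j)) SlitPlane.u) ∧
    -- `S_{i,j}` is quadratic or quartic over `ℚ(t)`
    (∀ i j : ℤ, Even (i + j) → (i, j) ∉ SlitPlane.halfLine →
      (minpoly (IntermediateField.adjoin ℚ {SlitPlane.t}) (SlitPlane.S i j : ℚ⸨X⸩)).natDegree = 2 ∨
      (minpoly (IntermediateField.adjoin ℚ {SlitPlane.t}) (SlitPlane.S i j : ℚ⸨X⸩)).natDegree = 4) ∧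
    -- `S_{1,1}`
    ((SlitPlane.S 1 1 : ℚ⸨X⸩) =
        SlitPlane.u * (1 + SlitPlane.u ^ 2) / (1 - SlitPlane.u ^ 2) ∧
      (SlitPlane.S 1 1 : ℚ⸨X⸩) =
        (2 - SlitPlane.rMinus - SlitPlane.rPlus) / (4 * SlitPlane.t) ∧
      SlitPlane.S 1 1 = SlitPlane.oddSeries fun n => (catalan (2 * n + 1) : ℚ)) ∧
    -- `S_{-1,1}`
    ((SlitPlane.S (-1) 1 : ℚ⸨X⸩) = SlitPlane.u ∧
      (SlitPlane.S (-1) 1 : ℚ⸨X⸩) = (SlitPlane.rPlus - 1) / (SlitPlane.rMinus + 1) ∧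
      SlitPlane.S (-1) 1 =
        SlitPlane.oddSeries fun n => 2 * 4 ^ n * (catalan n : ℚ) - (catalan (2 * n + 1) : ℚ)) ∧
    -- `S_{0,2}`
    ((SlitPlane.S 0 2 : ℚ⸨X⸩) = 2 * SlitPlane.u ^ 2 / (1 - SlitPlane.u ^ 2) ∧
      (SlitPlane.S 0 2 : ℚ⸨X⸩) =
        (SlitPlane.rPlus - SlitPlane.rMinus - 4 * SlitPlane.t) / (4 * SlitPlane.t) ∧
      SlitPlane.S 0 2 =
        SlitPlane.evenSeries fun n => if 1 ≤ n then (catalan (2 * n) : ℚ) else 0) ∧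
    -- `S_{2i,0}` for `i ≥ 1`
    (∀ i : ℕ, 1 ≤ i →
      (SlitPlane.S (2 * (i : ℤ)) 0 : ℚ⸨X⸩) =
          ((2 * i).choose i : ℚ⸨X⸩) * SlitPlane.t ^ (2 * i) *
            SlitPlane.catalanAtFourTSq ^ (2 * i) ∧
      SlitPlane.S (2 * (i : ℤ)) 0 = SlitPlane.evenSeries fun n =>
        if i ≤ n then
          (i : ℚ) / (n : ℚ) * ((2 * i).choose i : ℚ) * ((2 * n).choose (n - i) : ℚ) * 4 ^ (n - i)
        else 0) := by
  refine ⟨SlitPlane.adjoin_u_eq, SlitPlane.S_mem_adjoin_u,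
    ⟨SlitPlane.numerator, SlitPlane.denominator, SlitPlane.primrec_numerator.to_comp,
      SlitPlane.primrec_denominator.to_comp, fun i j => ⟨?_, SlitPlane.S_eq_div i j⟩⟩,
    SlitPlane.minpoly_S_natDegree,
    ⟨SlitPlane.S_one_one_coe, SlitPlane.S_one_one_coe_t, SlitPlane.S_one_one_eq⟩,
    ⟨?_, ?_, SlitPlane.S_neg_one_one_eq⟩,
    ⟨SlitPlane.S_zero_two_coe, SlitPlane.S_zero_two_coe_t, SlitPlane.S_zero_two_eq⟩,
    fun i hi => ⟨SlitPlane.S_two_mul_zero_coe i, SlitPlane.S_two_mul_zero_eq_evenSeries i hi⟩⟩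
  · rw [SlitPlane.polyEval_denominator]
    exact SlitPlane.u_sub_pow_ne_zero _
  · rw [SlitPlane.S_neg_one_one, SlitPlane.u_eq]
  · rw [SlitPlane.S_neg_one_one, ← SlitPlane.u_eq, SlitPlane.u]
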